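/- Conventions. All graphs and hypergraphs are finite; partitions have non-empty parts, and $\mathcal Q\prec\mathcal P$ means that each part of $\mathcal Q$ lies in a part of $\mathcal P$. Let $\mathrm{Ack}_1(x)=2^x$ and, for $k\ge1$, let $\mathrm{Ack}_{k+1}(n)$ be the $n$-fold composition of $\mathrm{Ack}_k$ evaluated at $1$. A $k$-graph is $k$-partite on disjoint vertex classes $(V_1,\dots,V_k)$, which cover its vertex set, if each edge has exactly one vertex in each $V_i$; its density is $e(H)/\prod_i|V_i|$. Elements of $V_1\times\dots\times V_k$ are identified with $k$-element sets. An $r$-polyad is an $r$-partite $(r-1)$-graph $P$ on classes $(Z_1,\dots,Z_r)$, identified with $(F_1,\dots,F_r)$, where $F_i$ is the subgraph induced on $\bigcup_{j\ne i}Z_j$ (for $r=2$, $F_1=Z_2$ and $F_2=Z_1$); $\mathcal K(P)$ is the set of $e\in Z_1\times\dots\times Z_r$ such that deleting from $e$ its vertex in $Z_i$ gives an edge of $F_i$, for every $i$. A $k$-partition $\mathcal P=\mathcal P^{(1)}\cup\dots\cup\mathcal P^{(k)}$ on $V$ consists of a partition $\mathcal P^{(1)}$ of $V$ and, for $2\le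 r\le k$, a partition $\mathcal P^{(r)}$ of the set of all $r$-subsets of $V$ meeting each part of $\mathcal P^{(1)}$ at most once, such that each $F\in\mathcal P^{(r)}$ is contained in $\mathcal K(P)$ for an $r$-polyad $P=(F_1,\dots,F_r)$ whose vertex classes are distinct parts of $\mathcal P^{(1)}$ and with all $F_i\in\mathcal P^{(r-1)}$. This $P$, unique up to the order of its classes, is the polyad underlying $F$. For a bipartite graph $G$, write $d_G(A,B)=e_G(A,B)/(|A||B|)$. A bipartite graph $G$ on $(A,B)$ is $\langle\delta\rangle$-regular if $d_G(A',B')\ge\frac12d_G(A,B)$ for all $A'\subseteq A$, $B'\subseteq B$ with $|A'|\ge\delta|A|$, $|B'|\ge\delta|B|$. If $\mathcal E,\mathcal V$ are partitions of the two sides of a bipartite graph $G$, then $\mathcal E\cup\mathcal V$ is a $\langle\delta\rangle$-regular partition of $G$ if one can add/remove at most $\delta\, e(G)$ edges so that the bipartite graph induced on each $(A,B)\in\mathcal E\times\mathcal V$ becomes $\langle\delta\rangle$-regular. For a $k$-partite $k$-graph $H$ on $(V_1,\dots,V_k)$ let $G_H^i$ be the bipartite graph on $\big(\prod_{j\ne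 i}V_j,\,V_i\big)$ in which $f$ and $v$ are adjacent if $f\cup\{v\}\in E(H)$. A $k$-partition $\mathcal P$ is $\langle\delta\rangle$-good if for all $2\le r\le k$, all $F\in\mathcal P^{(r)}$ with underlying polyad $(F_1,\dots,F_r)$ on $(Z_1,\dots,Z_r)$, and all $1\le i\le r$, the induced subgraph $G_F^i[F_i,Z_i]$ is $\langle\delta\rangle$-regular on $(F_i,Z_i)$. For $k\ge2$, a $\langle\delta\rangle$-regular partition of $H$ is a $\langle\delta\rangle$-good $(k-1)$-partition $\mathcal P$ on $V(H)$ with $\mathcal P^{(1)}\prec\{V_1,\dots,V_k\}$ such that, for every $1\le i\le k$, $\{E\in\mathcal P^{(k-1)}: E\subseteq\prod_{j\ne i}V_j\}\cup\{Z\in\mathcal P^{(1)}: Z\subseteq V_i\}$ is a $\langle\delta\rangle$-regular partition of $G_H^i$. Theorem. For every $k\ge2$ and $s\in\mathbb N$ there exist a $k$-partite $k$-graph $H$ of density $2^{-s-k}$ and a partition $\mathcal V_0$ of $V(H)$ with $|\mathcal V_0|\le2^{200}k$ such that every $\langle2^{-16^k}\rangle$-regular partition $\mathcal P$ of $H$ with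 $\mathcal P^{(1)}\prec\mathcal V_0$ satisfies $|\mathcal P^{(1)}|\ge\mathrm{Ack}_k(s)$. -/

import Mathlib

open Finset

/-- The Ackermann hierarchy: `Ack 1 x = 2 ^ x`, and `Ack (k + 1) n` is the `n`-fold composition of
`Ack k`, evaluated at `1`.  The value at level `0` is irrelevant. -/
def Ack : ℕ → ℕ → ℕ
  | 0, _ => 0
  | 1, x => 2 ^ x
  | k + 2, n => (Ack (k + 1))^[n] 1

section Bipartite

variable {α β : Type*} [DecidableEq α] [DecidableEq β]

/-- The density `d_G(A, B) = e_G(A, B) / (|A| |B|)` between `A` and `B` of the bipartite graph with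
edge set `G`. -/
noncomputable def bipDensity (G : Finset (α × β)) (A : Finset α) (B : Finset β) : ℝ :=
  ((G ∩ A ×ˢ B).card : ℝ) / ((A.card : ℝ) * (B.card : ℝ))

/-- A bipartite graph with edge set `G`, between the vertex sets `A` and `B`, is `⟨δ⟩`-regular:
`d(A', B') ≥ d(A, B) / 2` for all `A' ⊆ A`, `B' ⊆ B` with `|A'| ≥ δ |A|`, `|B'| ≥ δ |B|`. -/
def BipRegular (δ : ℝ) (G : Finset (α × β)) (A : Finset α) (B : Finset β) : Prop :=
  ∀ A' ⊆ A, ∀ B' ⊆ B, δ * (A.card : ℝ) ≤ (A'.card : ℝ) → δ * (B.card : ℝ) ≤ (B'.card : ℝ) →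
    (1 / 2 : ℝ) * bipDensity G A B ≤ bipDensity G A' B'

/-- Let `G` be the edge set of a bipartite graph on `(X, Y)`, and let `PX`, `PY` be the families of
parts of a partition of `X` and of a partition of `Y`.  The vertex partition `PX ∪ PY` of `G` is
`⟨δ⟩`-regular: one can add/remove at most `δ * e(G)` edges so that the bipartite graph induced on
each pair of parts is `⟨δ⟩`-regular.  Pairs of parts on the same side span no edges, so that only
the pairs in `PX × PY` matter. -/
def BipRegularPartition (δ : ℝ) (X : Finset α) (Y : Finset β) (G : Finset (α × β))
    (PX : Finset (Finset α)) (PY : Finset (Finset β)) : Prop :=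
  ∃ G' : Finset (α × β), G' ⊆ X ×ˢ Y ∧
    ((symmDiff G G').card : ℝ) ≤ δ * (G.card : ℝ) ∧
    ∀ A ∈ PX, ∀ B ∈ PY, BipRegular δ G' A B

end Bipartite

section Hypergraph

variable {V : Type*} [DecidableEq V]

/-- The complete partite hypergraph `∏_{i ∈ I} Z i` on the (pairwise disjoint) vertex classes `Z i`,
`i ∈ I`: a tuple is identified with the set of its entries. -/
def transversals {ι : Type*} [DecidableEq ι] (I : Finset ι) (Z : ι → Finset V) :
    Finset (Finset V) :=
  (I.biUnion Z).powerset.filter fun e => ∀ i ∈ I, (e ∩ Z i).card = 1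

/-- The bipartite graph on `(X, Y)`, where `X` is a set of `(r-1)`-sets of vertices and `Y` a set of
vertices, in which `f ∈ X` and `v ∈ Y` are adjacent when `f ∪ {v}` is an edge of the `r`-graph `E`.

For `E` with vertex classes `Z 0, …, Z (r-1)`, it is the auxiliary graph `G_E^i` when
`X = ∏_{j ≠ i} Z j` and `Y = Z i`, and it is `G_{E,P}^i = G_E^i[F i, Z i]` when `X = F i` and
`Y = Z i` for a polyad `P = (F 0, …, F (r-1))`. -/
def auxGraph (E : Finset (Finset V)) (X : Finset (Finset V)) (Y : Finset V) :
    Finset (Finset V × V) :=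
  (X ×ˢ Y).filter fun p => insert p.2 p.1 ∈ E

variable [Fintype V]

/-- `Cross_r(Z)`: the `r`-sets of vertices that meet each part of `Z` in at most one vertex. -/
def cross (r : ℕ) (Z : Finpartition (univ : Finset V)) : Finset (Finset V) :=
  (univ.powersetCard r).filter fun e => ∀ W ∈ Z.parts, (e ∩ W).card ≤ 1

/-- The `r`-cliques `𝒦(P)` of the `r`-polyad `P = (F 0, …, F (r-1))` on the vertex classes
`Z 0, …, Z (r-1)`: the sets with exactly one vertex in each class such that removing the vertex in
`Z i` leaves an edge of `F i`, for each `i`. -/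
def polyadCliques {r : ℕ} (Z : Fin r → Finset V) (F : Fin r → Finset (Finset V)) :
    Finset (Finset V) :=
  (transversals univ Z).filter fun e => ∀ i, e \ Z i ∈ F i

/-- `Z`, `F` describe an `r`-polyad whose vertex classes are distinct clusters of the vertex
partition `P1`, and each of whose `(r-1)`-partite `(r-1)`-graphs `F i`, on the classes `Z j` with
`j ≠ i`, is a member of the family `Q`. -/
def IsPolyadOf {r : ℕ} (P1 : Finpartition (univ : Finset V)) (Q : Finset (Finset (Finset V)))
    (Z : Fin r → Finset V) (F : Fin r → Finset (Finset V)) : Prop :=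
  Function.Injective Z ∧ (∀ i, Z i ∈ P1.parts) ∧
    ∀ i, F i ∈ Q ∧ F i ⊆ transversals (univ.erase i) Z

variable (V) in
/-- A `k`-partition on `V`: a vertex partition together with, for `2 ≤ r ≤ k`, a partition of
`Cross_r` of the vertex partition, each of whose parts is contained in `𝒦(P)` for some `r`-polyad
`P` formed by parts of level `r - 1`.  At level `1`, a cluster `W` of the vertex partition is
identified with the set of singletons `{v}`, `v ∈ W`.  The levels `r = 0` and `r > k` carry no
information and are never used. -/
structure KPartition (k : ℕ) where
  vertexPart : Finpartition (univ : Finset V)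
  part : (r : ℕ) → Finpartition (cross r vertexPart)
  part_one : (part 1).parts = vertexPart.parts.image (powersetCard 1)
  part_refines : ∀ r, 2 ≤ r → r ≤ k → ∀ E ∈ (part r).parts,
    ∃ (Z : Fin r → Finset V) (F : Fin r → Finset (Finset V)),
      IsPolyadOf vertexPart (part (r - 1)).parts Z F ∧ E ⊆ polyadCliques Z F

/-- A `k`-partition is `⟨δ⟩`-good: for `2 ≤ r ≤ k` and each part `E` of level `r`, with underlying
`r`-polyad `P = (F 0, …, F (r-1))` on the clusters `Z 0, …, Z (r-1)`, all bipartite graphs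
`G_{E,P}^i` are `⟨δ⟩`-regular.  (The underlying polyad is unique up to the order of its classes.) -/
def KPartition.IsGood {k : ℕ} (P : KPartition V k) (δ : ℝ) : Prop :=
  ∀ r, 2 ≤ r → r ≤ k → ∀ E ∈ (P.part r).parts,
    ∀ (Z : Fin r → Finset V) (F : Fin r → Finset (Finset V)),
      IsPolyadOf P.vertexPart (P.part (r - 1)).parts Z F → E ⊆ polyadCliques Z F →
        ∀ i, BipRegular δ (auxGraph E (F i) (Z i)) (F i) (Z i)

variable (V) in
/-- A `k`-partite `k`-graph with vertex set `V`. -/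
structure PartiteHypergraph (k : ℕ) where
  /-- The vertex classes. -/
  cls : Fin k → Finset V
  cls_disjoint : ∀ i j, i ≠ j → Disjoint (cls i) (cls j)
  cls_cover : univ.biUnion cls = univ
  edges : Finset (Finset V)
  edges_subset : edges ⊆ transversals univ cls

namespace PartiteHypergraph

variable {k : ℕ} (H : PartiteHypergraph V k)

/-- The density `e(H) / ∏ |V_i|`. -/
noncomputable def density : ℝ := (H.edges.card : ℝ) / ∏ i, ((H.cls i).card : ℝ)

/-- The complete `(k-1)`-partite `(k-1)`-graph `∏_{j ≠ i} V_j`. -/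
def coProd (i : Fin k) : Finset (Finset V) := transversals (univ.erase i) H.cls

/-- The clusters of `P` that are contained in the vertex class `V_i`. -/
def vertexParts (P : KPartition V (k - 1)) (i : Fin k) : Finset (Finset V) :=
  P.vertexPart.parts.filter fun W => W ⊆ H.cls i

/-- The parts of the top level of `P` that are contained in `∏_{j ≠ i} V_j`. -/
def edgeParts (P : KPartition V (k - 1)) (i : Fin k) : Finset (Finset (Finset V)) :=
  (P.part (k - 1)).parts.filter fun E => E ⊆ H.coProd i

/-- `P` is a `⟨δ⟩`-regular partition of the `k`-partite `k`-graph `H`: a `⟨δ⟩`-good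
`(k-1)`-partition whose vertex part refines the vertex classes of `H`, and which induces a
`⟨δ⟩`-regular partition of each auxiliary bipartite graph `G_H^i` on `(∏_{j ≠ i} V_j, V_i)`. -/
def IsRegularPartition (P : KPartition V (k - 1)) (δ : ℝ) : Prop :=
  P.IsGood δ ∧ (∀ W ∈ P.vertexPart.parts, ∃ i, W ⊆ H.cls i) ∧
    ∀ i, BipRegularPartition δ (H.coProd i) (H.cls i) (auxGraph H.edges (H.coProd i) (H.cls i))
      (H.edgeParts P i) (H.vertexParts P i)

end PartiteHypergraph

end Hypergraph

/-- The window of length `d` of the bit sequence `s` starting at position `m`. -/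
def blk (m d : ℕ) (s : ℕ → Bool) : Fin d → Bool := fun i => s (m + i)

/-- The first `n` bits `b x` are uniformly distributed when `x` ranges over `X`. -/
def UnifBits {α : Type*} (X : Finset α) (b : α → ℕ → Bool) (n : ℕ) : Prop :=
  ∀ c : ℕ → Bool, #{x ∈ X | ∀ i < n, b x i = c i} * 2 ^ n = #X

section UniformBits

variable {α : Type*} {X : Finset α} {b : α → ℕ → Bool} {n : ℕ}

theorem blk_eq_iff {m d : ℕ} {s s' : ℕ → Bool} :
    blk m d s = blk m d s' ↔ ∀ i, m ≤ i → i < m + d → s i = s' i := by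
  constructor
  · intro h i hi hi'
    have := congrFun h ⟨i - m, by omega⟩
    simpa [blk, Nat.add_sub_cancel' hi] using this
  · intro h
    funext i
    exact h _ (by omega) (by omega)

theorem UnifBits.pred (h : UnifBits X b (n + 1)) : UnifBits X b n := by
  classical
  intro c
  have h1 := h (Function.update c n true)
  have h2 := h (Function.update c n false)
  have key : #{x ∈ X | ∀ i < n, b x i = c i} =
      #{x ∈ X | ∀ i < n + 1, b x i = Function.update c n true i} +
      #{x ∈ X | ∀ i < n + 1, b x i = Function.update c n false i} := by
    rw [← card_union_of_disjoint]
    · congr 1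
      ext x
      simp only [mem_filter, mem_union, ← and_or_left, and_congr_right_iff]
      intro _
      constructor
      · intro hx
        cases hb : b x n
        · right
          intro i hi
          rcases Nat.lt_succ_iff_lt_or_eq.1 hi with hi | rfl
          · rw [Function.update_of_ne hi.ne, hx i hi]
          · simp [hb]
        · left
          intro i hi
          rcases Nat.lt_succ_iff_lt_or_eq.1 hi with hi | rfl
          · rw [Function.update_of_ne hi.ne, hx i hi]
          · simp [hb]
      · rintro (hx | hx) i hi
        · have := hx i (by omega)
          rwa [Function.update_of_ne hi.ne] at this
        · have := hx i (by omega)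
          rwa [Function.update_of_ne hi.ne] at this
    · rw [disjoint_filter]
      intro x _ hx hx'
      have e1 := hx n (by omega)
      have e2 := hx' n (by omega)
      simp [e1] at e2
  rw [key]
  rw [pow_succ] at h1 h2
  linarith

theorem UnifBits.mono {n' : ℕ} (h : UnifBits X b n) (hn : n' ≤ n) : UnifBits X b n' := by
  induction n, hn using Nat.le_induction with
  | base => exact h
  | succ n _ ih => exact ih h.pred

theorem UnifBits.card_eq (h : UnifBits X b n) (c : ℕ → Bool) :
    (#{x ∈ X | ∀ i < n, b x i = c i} : ℝ) = #X / 2 ^ n := by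
  rw [eq_div_iff (by positivity)]
  exact_mod_cast h c

theorem UnifBits.sum_mul_blk (h : UnifBits X b n) {m d : ℕ} (hmd : m + d ≤ n) (ψ : α → ℝ)
    (hψ : ∀ x ∈ X, ∀ y ∈ X, (∀ i < m, b x i = b y i) → ψ x = ψ y) (φ : (Fin d → Bool) → ℝ) :
    ∑ x ∈ X, ψ x * φ (blk m d (b x)) = (∑ x ∈ X, ψ x) * ((∑ u, φ u) / 2 ^ d) := by
  classical
  have fib (f : α → ℝ) : ∑ x ∈ X, f x =
      ∑ p : Fin m → Bool, ∑ x ∈ X with blk 0 m (b x) = p, f x :=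
    (sum_fiberwise X (fun x => blk 0 m (b x)) f).symm
  rw [fib, fib ψ, sum_mul]
  refine sum_congr rfl fun p _ => ?_
  set ext : (Fin d → Bool) → ℕ → Bool := fun u i =>
    if hi : i < m then p ⟨i, hi⟩ else if hi : i - m < d then u ⟨i - m, hi⟩ else false with hext
  have hp (u : Fin d → Bool) (x : α) : blk 0 m (b x) = p ↔ ∀ i < m, b x i = ext u i := by
    constructor
    · rintro rfl i hi
      simp [hext, hi, blk]
    · intro hx
      funext i
      have := hx i i.2
      simpa [hext, blk] using this
  have hpu (u : Fin d → Bool) (x : α) :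
      (blk 0 m (b x) = p ∧ blk m d (b x) = u) ↔ ∀ i < m + d, b x i = ext u i := by
    rw [hp u]
    constructor
    · rintro ⟨h1, rfl⟩ i hi
      by_cases him : i < m
      · exact h1 i him
      · have : i - m < d := by omega
        have e : m + (i - m) = i := by omega
        simp [hext, him, this, blk, e]
    · intro hx
      refine ⟨fun i hi => hx i (by omega), ?_⟩
      funext i
      have := hx (m + i) (by omega)
      simpa [hext, blk] using this
  have c1 : (#{x ∈ X | blk 0 m (b x) = p} : ℝ) = #X / 2 ^ m := by
    rw [← (h.mono (by omega : m ≤ n)).card_eq (ext fun _ => false)]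
    simp only [hp fun _ => false]
  have c2 (u : Fin d → Bool) :
      (#{x ∈ {x ∈ X | blk 0 m (b x) = p} | blk m d (b x) = u} : ℝ) = #X / 2 ^ (m + d) := by
    rw [filter_filter, ← (h.mono hmd).card_eq (ext u)]
    simp only [hpu u]
  rcases (filter (fun x => blk 0 m (b x) = p) X).eq_empty_or_nonempty with he | ⟨y, hy⟩
  · simp [he]
  have hconst : ∀ x ∈ X.filter (fun x => blk 0 m (b x) = p), ψ x = ψ y := by
    intro x hx
    rw [mem_filter] at hx hy
    refine hψ x hx.1 y hy.1 fun i hi => ?_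
    have := (blk_eq_iff.1 (hx.2.trans hy.2.symm)) i (by omega) (by omega)
    exact this
  rw [sum_congr rfl hconst, sum_congr rfl fun x hx => by rw [hconst x hx], ← mul_sum, sum_const,
    nsmul_eq_mul, c1, ← sum_fiberwise _ (fun x => blk m d (b x))]
  have : ∀ u : Fin d → Bool, ∑ x ∈ {x ∈ X | blk 0 m (b x) = p} with blk m d (b x) = u,
      φ (blk m d (b x)) = #X / 2 ^ (m + d) * φ u := by
    intro u
    rw [← c2 u, ← nsmul_eq_mul, ← sum_const]
    exact sum_congr rfl fun x hx => by rw [(mem_filter.1 hx).2]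
  rw [sum_congr rfl fun u _ => this u, ← mul_sum, pow_add]
  field_simp

/-- Independence of consecutive windows of a uniform bit sequence. -/
theorem UnifBits.sum_mul_prod (h : UnifBits X b n) {m D : ℕ → ℕ} {i t : ℕ} (hit : i ≤ t)
    (hm : ∀ j < t, m j + D j = m (j + 1)) (hmn : m t ≤ n) (ψ : α → ℝ)
    (hψ : ∀ x ∈ X, ∀ y ∈ X, (∀ l < m i, b x l = b y l) → ψ x = ψ y)
    (φ : (j : ℕ) → (Fin (D j) → Bool) → ℝ) :
    ∑ x ∈ X, ψ x * ∏ j ∈ Ico i t, φ j (blk (m j) (D j) (b x)) =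
      (∑ x ∈ X, ψ x) * ∏ j ∈ Ico i t, (∑ u, φ j u) / 2 ^ D j := by
  induction t, hit using Nat.le_induction with
  | base => simp
  | succ t hit ih =>
    have hmt : m i ≤ m t := by
      clear ih
      induction t, hit using Nat.le_induction with
      | base => rfl
      | succ t hit ih =>
        have := hm t (by omega)
        exact (ih (fun j hj => hm j (by omega)) (by have := hm (t + 1) (by omega); omega)).trans
          (by omega)
    have hs := hm t (by omega)
    have ih' := ih (fun j hj => hm j (by omega)) (by omega)
    simp only [prod_Ico_succ_top hit, ← mul_assoc]
    rw [h.sum_mul_blk (by omega), ih']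
    intro x hx y hy hxy
    rw [hψ x hx y hy fun l hl => hxy l (by omega)]
    congr 1
    refine prod_congr rfl fun j hj => ?_
    rw [mem_Ico] at hj
    congr 1
    rw [blk_eq_iff]
    intro l _ hl
    refine hxy l ?_
    have : m (j + 1) ≤ m t := by
      have : ∀ q, j + 1 ≤ q → q ≤ t → m (j + 1) ≤ m q := by
        intro q hq
        induction q, hq using Nat.le_induction with
        | base => simp
        | succ q hq ih => intro hqt; have := hm q (by omega); exact (ih (by omega)).trans (by omega)
      exact this t (by omega) le_rfl
    have := hm j (by omega)
    omega

theorem UnifBits.sum_prod (h : UnifBits X b n) {m D : ℕ → ℕ} {i t : ℕ} (hit : i ≤ t)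
    (hm : ∀ j < t, m j + D j = m (j + 1)) (hmn : m t ≤ n)
    (φ : (j : ℕ) → (Fin (D j) → Bool) → ℝ) :
    ∑ x ∈ X, ∏ j ∈ Ico i t, φ j (blk (m j) (D j) (b x)) =
      #X * ∏ j ∈ Ico i t, (∑ u, φ j u) / 2 ^ D j := by
  simpa using h.sum_mul_prod hit hm hmn (fun _ => 1) (fun _ _ _ _ _ => rfl) φ

end UniformBits

/-- A family `E` of binary words `E x`, indexed by `x : A`, on the set `U` of coordinates: the words
are balanced and far apart, and the coordinates of a random word are uniform and have non-positive
pairwise correlations. -/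
structure GoodCode {A U : Type*} [Fintype A] [Fintype U] (E : A → U → Bool) : Prop where
  row_balanced : ∀ x c, #{u | E x u = c} * 2 = Fintype.card U
  row_dist : ∀ x x', x ≠ x' → ∀ c, Fintype.card U ≤ 16 * #{u | E x u = c ∧ E x' u ≠ c}
  col_balanced : ∀ u c, #{x | E x u = c} * 2 = Fintype.card A
  col_pair : ∀ u u', u ≠ u' → ∀ c, #{x | E x u = c ∧ E x u' = c} * 4 ≤ Fintype.card A

section Code

theorem GoodCode.congr {A U A' U' : Type*} [Fintype A] [Fintype U] [Fintype A'] [Fintype U']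
    {E : A → U → Bool} (h : GoodCode E) (f : A' ≃ A) (g : U' ≃ U) :
    GoodCode fun x u => E (f x) (g u) := by
  have cU (p : U → Prop) [DecidablePred p] : #{u | p (g u)} = #{u | p u} :=
    card_bij' (fun u _ => g u) (fun u _ => g.symm u) (by simp) (by simp) (by simp) (by simp)
  have cA (p : A → Prop) [DecidablePred p] : #{u | p (f u)} = #{u | p u} :=
    card_bij' (fun u _ => f u) (fun u _ => f.symm u) (by simp) (by simp) (by simp) (by simp)
  refine ⟨fun x c => ?_, fun x x' hx c => ?_, fun u c => ?_, fun u u' hu c => ?_⟩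
  · rw [cU fun u => E (f x) u = c, h.row_balanced, Fintype.card_congr g]
  · rw [cU fun u => E (f x) u = c ∧ E (f x') u ≠ c, Fintype.card_congr g]
    exact h.row_dist _ _ (f.injective.ne hx) c
  · rw [cA fun x => E x (g u) = c, h.col_balanced, Fintype.card_congr f]
  · rw [cA fun x => E x (g u) = c ∧ E x (g u') = c, Fintype.card_congr f]
    exact h.col_pair _ _ (g.injective.ne hu) c

theorem zmod_two_ne_iff {a b : ZMod 2} : a ≠ b ↔ a = b + 1 := by
  revert a b; decide

theorem zmod_two_eq_one {a : ZMod 2} (ha : a ≠ 0) : a = 1 := by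
  revert a; decide

/-- An affine function on `𝔽₂ⁿ` that changes its value in direction `i` is balanced. -/
theorem card_filter_mul_two_of_flip {n : ℕ} {B : Type*} [Fintype B] [DecidableEq B] (i : Fin n)
    (f : (Fin n → ZMod 2) → B → ZMod 2) (hf : ∀ x b, f (x + Pi.single i 1) b = f x b + 1)
    (c : ZMod 2) :
    #{x : (Fin n → ZMod 2) × B | f x.1 x.2 = c} * 2 = 2 ^ n * Fintype.card B := by
  have h1 : #{x : (Fin n → ZMod 2) × B | f x.1 x.2 = c} =
      #{x : (Fin n → ZMod 2) × B | ¬ f x.1 x.2 = c} := by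
    have hs (x : Fin n → ZMod 2) : x + Pi.single i 1 + Pi.single i 1 = x := by
      funext j
      rw [Pi.add_apply, Pi.add_apply, add_assoc, CharTwo.add_self_eq_zero, add_zero]
    refine card_bij' (fun x _ => (x.1 + Pi.single i 1, x.2)) (fun x _ => (x.1 + Pi.single i 1, x.2))
      ?_ ?_ ?_ ?_
    · intro x hx
      simp only [mem_filter, mem_univ, true_and] at hx ⊢
      rw [hf, hx]
      simp
    · intro x hx
      simp only [mem_filter, mem_univ, true_and] at hx ⊢
      rw [hf, zmod_two_ne_iff.1 hx, add_assoc, CharTwo.add_self_eq_zero, add_zero]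
    · intro x _; simp [hs]
    · intro x _; simp [hs]
  have h2 := card_filter_add_card_filter_not (s := (univ : Finset ((Fin n → ZMod 2) × B)))
    (fun x => f x.1 x.2 = c)
  rw [← h1] at h2
  rw [mul_two, h2, card_univ, Fintype.card_prod, Fintype.card_fun, ZMod.card, Fintype.card_fin]

theorem card_filter_mul_two_of_flip' {n : ℕ} (i : Fin n) (f : (Fin n → ZMod 2) → ZMod 2)
    (hf : ∀ x, f (x + Pi.single i 1) = f x + 1) (c : ZMod 2) :
    #{x : Fin n → ZMod 2 | f x = c} * 2 = 2 ^ n := by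
  have := card_filter_mul_two_of_flip i (fun x (_ : Unit) => f x) (fun x _ => hf x) c
  rw [Fintype.card_unit, mul_one] at this
  rw [← this]
  congr 1
  exact card_bij' (fun x _ => (x, ())) (fun x _ => x.1) (by simp) (by simp) (by simp) (by simp)

/-- The graph of a function has as many points as the domain. -/
theorem card_filter_fst_eq {A B : Type*} [Fintype A] [Fintype B] [DecidableEq A] (g : B → A)
    (p : B → Prop) [DecidablePred p] :
    #{u : A × B | u.1 = g u.2 ∧ p u.2} = #{y | p y} :=
  card_bij' (fun u _ => u.2) (fun y _ => (g y, y)) (by simp) (by simp)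
    (by rintro ⟨a, b⟩; simp +contextual) (by simp)

theorem exists_random_functionals (e l : ℕ) (he : 3 ≤ e) (hl : 1 + e + l < 3 * 2 ^ (e - 3)) :
    ∃ h : (Fin e → ZMod 2) → (Fin l → ZMod 2), ∀ (x₀ : ZMod 2) (x₁ : Fin e → ZMod 2)
      (x₂ : Fin l → ZMod 2), x₂ ≠ 0 →
        2 ^ e ≤ 8 * #{y | x₀ + x₁ ⬝ᵥ y + x₂ ⬝ᵥ h y ≠ 0} := by
  classical
  by_contra! hcon
  set n' := 2 ^ (e - 3) with hn'
  have hn : 2 ^ e = 8 * n' := by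
    rw [hn', show (8 : ℕ) = 2 ^ 3 by norm_num, ← pow_add]; congr 1; omega
  set T := ZMod 2 × (Fin e → ZMod 2) × {x : Fin l → ZMod 2 // x ≠ 0}
  set val : T → ((Fin e → ZMod 2) → (Fin l → ZMod 2)) → (Fin e → ZMod 2) → ZMod 2 :=
    fun x h y => x.1 + x.2.1 ⬝ᵥ y + x.2.2.1 ⬝ᵥ h y with hval
  set s : ZMod 2 → ℝ := fun z => if z = 0 then 1 else 1 / 4 with hs
  have hspos (z) : 0 ≤ s z := by simp only [hs]; split_ifs <;> norm_num
  have prod_s (x : T) (h) : ∏ y, s (val x h y) = (1 / 4) ^ #{y | val x h y ≠ 0} := by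
    simp only [hs]
    rw [prod_ite, prod_const_one, one_mul, prod_const]
  have avg (x : T) (y : Fin e → ZMod 2) :
      ∑ a : Fin l → ZMod 2, s (x.1 + x.2.1 ⬝ᵥ y + x.2.2.1 ⬝ᵥ a) = 2 ^ l * (5 / 8) := by
    obtain ⟨i, hi⟩ : ∃ i, x.2.2.1 i ≠ 0 := by
      by_contra! hh
      exact x.2.2.2 (funext hh)
    have hi1 : x.2.2.1 i = 1 := zmod_two_eq_one hi
    have flip := card_filter_mul_two_of_flip' i (fun a => x.1 + x.2.1 ⬝ᵥ y + x.2.2.1 ⬝ᵥ a)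
      (fun a => by rw [dotProduct_add, dotProduct_single, hi1]; ring)
    have f0 : (#{a : Fin l → ZMod 2 | x.1 + x.2.1 ⬝ᵥ y + x.2.2.1 ⬝ᵥ a = 0} : ℝ) * 2 = 2 ^ l := by
      exact_mod_cast flip 0
    have f1 : (#{a : Fin l → ZMod 2 | ¬ x.1 + x.2.1 ⬝ᵥ y + x.2.2.1 ⬝ᵥ a = 0} : ℝ) * 2 = 2 ^ l := by
      have := flip 1
      rw [← Nat.cast_inj (R := ℝ)] at this
      push_cast at this
      rw [← this]
      congr 3
      ext a
      simp only [mem_filter, mem_univ, true_and]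
      rw [← ne_eq, zmod_two_ne_iff, zero_add]
    simp only [hs]
    rw [sum_ite, sum_const, sum_const, nsmul_eq_mul, nsmul_eq_mul]
    linarith
  have total (x : T) : ∑ h, ∏ y, s (val x h y) = (2 ^ l * (5 / 8)) ^ (8 * n') := by
    simp only [hval]
    rw [← Fintype.prod_sum (fun (y : Fin e → ZMod 2) (a : Fin l → ZMod 2) =>
      s (x.1 + x.2.1 ⬝ᵥ y + x.2.2.1 ⬝ᵥ a))]
    simp only [avg]
    rw [prod_const, card_univ, Fintype.card_fun, ZMod.card, Fintype.card_fin, hn]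
  have lower (h) : (1 / 4 : ℝ) ^ n' ≤ ∑ x : T, ∏ y, s (val x h y) := by
    obtain ⟨x₀, x₁, x₂, hx₂, hx⟩ := hcon h
    refine le_trans ?_ (single_le_sum (f := fun x : T => ∏ y, s (val x h y))
      (fun x _ => prod_nonneg fun y _ => hspos _) (mem_univ (⟨x₀, x₁, x₂, hx₂⟩ : T)))
    rw [prod_s]
    refine pow_le_pow_of_le_one (by norm_num) (by norm_num) ?_
    simp only [hval]
    omega
  have hcardT : (Fintype.card T : ℝ) ≤ 2 ^ (1 + e + l) := by
    have : Fintype.card T ≤ 2 ^ (1 + e + l) := by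
      rw [Fintype.card_prod, Fintype.card_prod, ZMod.card, Fintype.card_fun, ZMod.card,
        Fintype.card_fin, pow_add, pow_add, pow_one, mul_assoc]
      gcongr
      refine (Fintype.card_subtype_le _).trans ?_
      rw [Fintype.card_fun, ZMod.card, Fintype.card_fin]
    exact_mod_cast this
  have main : (2 ^ l : ℝ) ^ (8 * n') * (1 / 4) ^ n' ≤
      2 ^ (1 + e + l) * (2 ^ l * (5 / 8)) ^ (8 * n') := by
    calc (2 ^ l : ℝ) ^ (8 * n') * (1 / 4) ^ n'
        = ∑ _h : (Fin e → ZMod 2) → (Fin l → ZMod 2), (1 / 4 : ℝ) ^ n' := by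
          rw [sum_const, card_univ, Fintype.card_fun, Fintype.card_fun, Fintype.card_fun, ZMod.card,
            Fintype.card_fin, Fintype.card_fin, hn, nsmul_eq_mul]
          push_cast
          rfl
      _ ≤ ∑ h, ∑ x : T, ∏ y, s (val x h y) := sum_le_sum fun h _ => lower h
      _ = Fintype.card T * (2 ^ l * (5 / 8)) ^ (8 * n') := by
          rw [sum_comm, sum_congr rfl fun x _ => total x, sum_const, card_univ, nsmul_eq_mul]
      _ ≤ _ := by gcongr
  rw [mul_pow, ← mul_assoc, mul_comm ((2 : ℝ) ^ (1 + e + l)), mul_assoc] at main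
  have main2 := le_of_mul_le_mul_left main (by positivity)
  have h58 : (5 / 8 : ℝ) ^ (8 * n') ≤ (1 / 32) ^ n' := by
    rw [pow_mul]
    gcongr
    norm_num
  have h2 : (2 : ℝ) ^ (1 + e + l) < 8 ^ n' := by
    rw [show (8 : ℝ) = 2 ^ 3 by norm_num, ← pow_mul]
    exact pow_lt_pow_right₀ (by norm_num) hl
  have h3 : (2 : ℝ) ^ (1 + e + l) * (5 / 8) ^ (8 * n') < 8 ^ n' * (1 / 32) ^ n' := by
    calc _ ≤ (2 : ℝ) ^ (1 + e + l) * (1 / 32) ^ n' := by gcongr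
      _ < _ := by gcongr
  rw [← mul_pow] at h3
  norm_num at h3 main2
  linarith

theorem exists_goodCode (d : ℕ) (hd : 8 ≤ d) :
    ∃ E : (Fin (2 ^ (d - 4)) → Bool) → (Fin d → Bool) → Bool, GoodCode E := by
  classical
  obtain ⟨e, rfl⟩ : ∃ e, d = e + 1 := ⟨d - 1, by omega⟩
  have hpow : e + 1 ≤ 2 ^ (e - 3) := by
    obtain ⟨f, rfl⟩ : ∃ f, e = f + 7 := ⟨e - 7, by omega⟩
    rw [show f + 7 - 3 = f + 4 by omega, pow_add]
    have := Nat.lt_two_pow_self (n := f)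
    omega
  obtain ⟨l, hl⟩ : ∃ l, 2 ^ (e - 3) = 1 + e + l := ⟨2 ^ (e - 3) - 1 - e, by omega⟩
  obtain ⟨h, hh⟩ := exists_random_functionals e l (by omega) (by omega)
  set A := ZMod 2 × (Fin e → ZMod 2) × (Fin l → ZMod 2)
  set U := ZMod 2 × (Fin e → ZMod 2)
  have cardU : Fintype.card U = 2 * 2 ^ e := by simp [U]
  have cardA : Fintype.card A = 2 * (2 ^ e * 2 ^ l) := by simp [A]
  have weight (x : A) (hx : x ≠ 0) :
      2 ^ e ≤ 8 * #{y | x.1 + x.2.1 ⬝ᵥ y + x.2.2 ⬝ᵥ h y ≠ 0} := by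
    by_cases h2 : x.2.2 = 0
    · by_cases h1 : x.2.1 = 0
      · have h0 : x.1 ≠ 0 := fun h0 => hx (Prod.ext h0 (Prod.ext h1 h2))
        simp [h1, h2, h0]
      · obtain ⟨i, hi⟩ : ∃ i, x.2.1 i ≠ 0 := by
          by_contra! hc
          exact h1 (funext hc)
        replace hi := zmod_two_eq_one hi
        have := card_filter_mul_two_of_flip' i (fun y => x.1 + x.2.1 ⬝ᵥ y)
          (fun y => by rw [dotProduct_add, dotProduct_single, hi]; ring) 1
        have e1 : #{y | x.1 + x.2.1 ⬝ᵥ y + x.2.2 ⬝ᵥ h y ≠ 0} =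
            #{y | x.1 + x.2.1 ⬝ᵥ y = 1} := by
          congr 1
          ext y
          simp only [mem_filter, mem_univ, true_and, h2, zero_dotProduct, add_zero]
          rw [zmod_two_ne_iff, zero_add]
        omega
    · exact hh _ _ _ h2
  set val : A → U → ZMod 2 := fun x u => u.1 + (x.1 + x.2.1 ⬝ᵥ u.2 + x.2.2 ⬝ᵥ h u.2) with hval
  set E : A → U → Bool := fun x u => decide (val x u = 1) with hE
  have Eeq (x u c) : E x u = c ↔ val x u = if c then 1 else 0 := by
    simp only [hE]
    generalize val x u = z
    revert z c
    decide
  have good : GoodCode E := by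
    refine ⟨fun x c => ?_, fun x x' hx c => ?_, fun u c => ?_, fun u u' hu c => ?_⟩
    · simp only [Eeq]
      generalize (if c then 1 else 0 : ZMod 2) = z
      have := card_filter_fst_eq (fun y => z - (x.1 + x.2.1 ⬝ᵥ y + x.2.2 ⬝ᵥ h y))
        (fun _ : Fin e → ZMod 2 => True)
      simp only [and_true, filter_true, card_univ, Fintype.card_fun, ZMod.card, Fintype.card_fin]
        at this
      simp only [hval, ← eq_sub_iff_add_eq]
      rw [this, cardU]
      ring
    · simp only [Eeq, ne_eq]
      generalize (if c then 1 else 0 : ZMod 2) = z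
      have := card_filter_fst_eq (fun y => z - (x.1 + x.2.1 ⬝ᵥ y + x.2.2 ⬝ᵥ h y))
        (fun y : Fin e → ZMod 2 => (x.1 - x'.1) + (x.2.1 - x'.2.1) ⬝ᵥ y + (x.2.2 - x'.2.2) ⬝ᵥ h y ≠ 0)
      have hw : 2 ^ e ≤ 8 * #{y | (x.1 - x'.1) + (x.2.1 - x'.2.1) ⬝ᵥ y +
          (x.2.2 - x'.2.2) ⬝ᵥ h y ≠ 0} := weight (x.1 - x'.1, x.2.1 - x'.2.1, x.2.2 - x'.2.2) (by
        intro h0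
        exact hx (Prod.ext (sub_eq_zero.1 (congrArg (fun z : A => z.1) h0))
          (Prod.ext (sub_eq_zero.1 (congrArg (fun z : A => z.2.1) h0))
            (sub_eq_zero.1 (congrArg (fun z : A => z.2.2) h0)))))
      rw [cardU]
      have e1 : #{u : U | val x u = z ∧ ¬ val x' u = z} =
          #{y | (x.1 - x'.1) + (x.2.1 - x'.2.1) ⬝ᵥ y + (x.2.2 - x'.2.2) ⬝ᵥ h y ≠ 0} := by
        refine Eq.trans ?_ (this.trans (by congr!))
        congr 1
        ext u
        simp only [mem_filter, mem_univ, true_and, hval, ← eq_sub_iff_add_eq,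
          sub_dotProduct, ne_eq]
        refine and_congr_right fun hu => ?_
        rw [hu, not_iff_not, ← sub_eq_zero]
        constructor <;> intro h' <;> linear_combination -h'
      rw [e1]
      omega
    · simp only [Eeq]
      generalize (if c then 1 else 0 : ZMod 2) = z
      have := card_filter_fst_eq
        (fun y : (Fin e → ZMod 2) × (Fin l → ZMod 2) => z - u.1 - (y.1 ⬝ᵥ u.2 + y.2 ⬝ᵥ h u.2))
        (fun _ => True)
      simp only [and_true, filter_true, card_univ, Fintype.card_prod, Fintype.card_fun, ZMod.card,
        Fintype.card_fin] at this
      have e1 : #{x : A | val x u = z} =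
          #{x : A | x.1 = z - u.1 - (x.2.1 ⬝ᵥ u.2 + x.2.2 ⬝ᵥ h u.2)} := by
        congr 1
        ext x
        simp only [mem_filter, mem_univ, true_and, hval]
        constructor <;> intro h' <;> linear_combination h'
      rw [e1, this, cardA]
      ring
    · simp only [Eeq]
      generalize (if c then 1 else 0 : ZMod 2) = z
      have := card_filter_fst_eq
        (fun y : (Fin e → ZMod 2) × (Fin l → ZMod 2) => z - u.1 - (y.1 ⬝ᵥ u.2 + y.2 ⬝ᵥ h u.2))
        (fun y => y.1 ⬝ᵥ (u'.2 - u.2) + y.2 ⬝ᵥ (h u'.2 - h u.2) = u.1 - u'.1)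
      have e1 : #{x : A | val x u = z ∧ val x u' = z} =
          #{x : A | x.1 = z - u.1 - (x.2.1 ⬝ᵥ u.2 + x.2.2 ⬝ᵥ h u.2) ∧
            x.2.1 ⬝ᵥ (u'.2 - u.2) + x.2.2 ⬝ᵥ (h u'.2 - h u.2) = u.1 - u'.1} := by
        congr 1
        ext x
        simp only [mem_filter, mem_univ, true_and, hval, dotProduct_sub]
        constructor
        · rintro ⟨h1, h2⟩
          exact ⟨by linear_combination h1, by linear_combination h2 - h1⟩
        · rintro ⟨h1, h2⟩
          exact ⟨by linear_combination h1, by linear_combination h1 + h2⟩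
      rw [e1, this, cardA]
      by_cases hu2 : u'.2 = u.2
      · have hu1 : u.1 - u'.1 ≠ 0 := by
          rw [sub_ne_zero]
          exact fun h1 => hu (Prod.ext h1 hu2.symm)
        simp [hu2, hu1.symm]
      · obtain ⟨i, hi⟩ : ∃ i, (u'.2 - u.2) i ≠ 0 := by
          by_contra! hc
          exact hu2 (sub_eq_zero.1 (funext hc))
        replace hi := zmod_two_eq_one hi
        have := card_filter_mul_two_of_flip i
          (fun (x : Fin e → ZMod 2) (x2 : Fin l → ZMod 2) =>
            x ⬝ᵥ (u'.2 - u.2) + x2 ⬝ᵥ (h u'.2 - h u.2))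
          (fun x b => by rw [add_dotProduct, single_dotProduct, hi]; ring) (u.1 - u'.1)
        rw [Fintype.card_fun, ZMod.card, Fintype.card_fin] at this
        omega
  have fA : (Fin (2 ^ (e + 1 - 4)) → Bool) ≃ A := Fintype.equivOfCardEq (by
    rw [cardA, Fintype.card_fun, Fintype.card_bool, Fintype.card_fin,
      show e + 1 - 4 = e - 3 by omega, hl, pow_add, pow_add]
    ring)
  have fU : (Fin (e + 1) → Bool) ≃ U := Fintype.equivOfCardEq (by
    rw [cardU, Fintype.card_fun, Fintype.card_bool, Fintype.card_fin, pow_succ, mul_comm])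
  exact ⟨_, good.congr fA fU⟩

end Code

/-- A sequence of codes: the `j`-th code `E j` is applied to the window `[l j, l (j + 1))` of a first
bit sequence and to the window `[m j, m (j + 1))` of a second one. -/
structure CodeTower where
  m : ℕ → ℕ
  D : ℕ → ℕ
  l : ℕ → ℕ
  lam : ℕ → ℕ
  E : (j : ℕ) → (Fin (lam j) → Bool) → (Fin (D j) → Bool) → Bool
  m_zero : m 0 = 1
  l_zero : l 0 = 0
  m_succ : ∀ j, m j + D j = m (j + 1)
  l_succ : ∀ j, l j + lam j = l (j + 1)
  good : ∀ j, GoodCode (E j)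

namespace CodeTower

variable (T : CodeTower)

/-- The bit assigned to the sequences `s` and `u` by the `j`-th code. -/
def val (j : ℕ) (s u : ℕ → Bool) : Bool :=
  T.E j (blk (T.l j) (T.lam j) s) (blk (T.m j) (T.D j) u)

/-- The codes number `i, …, t - 1` assign the bits `c` to `s` and `u`. -/
def Adj (c : ℕ → Bool) (i t : ℕ) (s u : ℕ → Bool) : Prop :=
  ∀ j ∈ Ico i t, T.val j s u = c j

instance (c : ℕ → Bool) (i t : ℕ) (s u : ℕ → Bool) : Decidable (T.Adj c i t s u) :=
  inferInstanceAs (Decidable (∀ j ∈ Ico i t, T.val j s u = c j))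

theorem m_mono : Monotone T.m := monotone_nat_of_le_succ fun j => by have := T.m_succ j; omega

theorem l_mono : Monotone T.l := monotone_nat_of_le_succ fun j => by have := T.l_succ j; omega

theorem one_le_m (j : ℕ) : 1 ≤ T.m j := T.m_zero ▸ T.m_mono (Nat.zero_le j)

theorem val_congr {j : ℕ} {s s' u u' : ℕ → Bool} (hs : ∀ q < T.l (j + 1), s q = s' q)
    (hu : ∀ q < T.m (j + 1), u q = u' q) : T.val j s u = T.val j s' u' := by
  have h1 := T.m_succ j
  have h2 := T.l_succ j
  unfold val
  rw [blk_eq_iff.2 fun q _ hq => hs q (by omega), blk_eq_iff.2 fun q _ hq => hu q (by omega)]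

theorem Adj.congr {c : ℕ → Bool} {i t : ℕ} {s s' u u' : ℕ → Bool} (h : T.Adj c i t s u)
    (hs : ∀ q < T.l t, s q = s' q) (hu : ∀ q < T.m t, u q = u' q) : T.Adj c i t s' u' := by
  intro j hj
  have hjt : j + 1 ≤ t := (mem_Ico.1 hj).2
  rw [← h j hj]
  exact (T.val_congr (fun q hq => hs q (hq.trans_le (T.l_mono hjt)))
    (fun q hq => hu q (hq.trans_le (T.m_mono hjt)))).symm

theorem adj_split {c : ℕ → Bool} {i t : ℕ} (hit : i ≤ t) {s u : ℕ → Bool} :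
    T.Adj c 0 t s u ↔ T.Adj c 0 i s u ∧ T.Adj c i t s u := by
  simp only [Adj, mem_Ico]
  constructor
  · exact fun h => ⟨fun j hj => h j (by omega), fun j hj => h j (by omega)⟩
  · rintro ⟨h1, h2⟩ j hj
    by_cases hji : j < i
    · exact h1 j (by omega)
    · exact h2 j (by omega)

theorem ind_adj (c : ℕ → Bool) (i t : ℕ) (s u : ℕ → Bool) :
    (if T.Adj c i t s u then 1 else 0 : ℝ) =
      ∏ j ∈ Ico i t, if T.val j s u = c j then 1 else 0 := by
  rw [prod_ite_zero]
  simp [Adj]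

variable {α β : Type*} {X : Finset α} {Y : Finset β} {a : α → ℕ → Bool} {b : β → ℕ → Bool}

section counts

variable {n : ℕ} (hY : UnifBits Y b n) {t : ℕ} (hmn : T.m t ≤ n)

include hY hmn

theorem card_adj {i : ℕ} (hit : i ≤ t) (c s : ℕ → Bool) (pd : β → Prop) [DecidablePred pd]
    (hpd : ∀ x ∈ Y, ∀ y ∈ Y, (∀ q < T.m i, b x q = b y q) → (pd x ↔ pd y)) :
    (#{v ∈ Y | pd v ∧ T.Adj c i t s (b v)} : ℝ) = #{v ∈ Y | pd v} / 2 ^ (t - i) := by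
  have key := hY.sum_mul_prod hit (fun j _ => T.m_succ j) hmn (fun v => if pd v then 1 else 0)
    (fun x hx y hy h => by simp only [hpd x hx y hy h])
    (fun j u => if T.E j (blk (T.l j) (T.lam j) s) u = c j then 1 else 0)
  have half : ∀ j ∈ Ico i t, (∑ u, if T.E j (blk (T.l j) (T.lam j) s) u = c j then 1 else 0 : ℝ) /
      2 ^ T.D j = 1 / 2 := by
    intro j _
    have := (T.good j).row_balanced (blk (T.l j) (T.lam j) s) (c j)
    rw [Fintype.card_fun, Fintype.card_bool, Fintype.card_fin, ← Nat.cast_inj (R := ℝ)] at this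
    push_cast at this
    rw [sum_boole, ← this]
    have h0 : (#{u | T.E j (blk (T.l j) (T.lam j) s) u = c j} : ℝ) ≠ 0 := by
      intro h0
      rw [h0, zero_mul] at this
      exact absurd this (by positivity)
    field_simp
  rw [prod_congr rfl half, prod_const, Nat.card_Ico, sum_boole] at key
  rw [card_filter]
  push_cast
  rw [div_eq_mul_one_div, ← one_div_pow, ← key]
  refine sum_congr rfl fun v _ => ?_
  rw [ite_and, T.ind_adj c i t s (b v)]
  by_cases hv : pd v
  · rw [if_pos hv, if_pos hv, one_mul]
    rfl
  · rw [if_neg hv, if_neg hv, zero_mul]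

theorem card_adj_adj_le {c s s' : ℕ → Bool} (hs : ∃ q < T.l t, s q ≠ s' q) (pd : β → Prop)
    [DecidablePred pd]
    (hpd : ∀ x ∈ Y, ∀ y ∈ Y, (∀ q < T.m 0, b x q = b y q) → (pd x ↔ pd y)) :
    (#{v ∈ Y | pd v ∧ T.Adj c 0 t s (b v) ∧ T.Adj c 0 t s' (b v)} : ℝ) ≤
      7 / 8 * (#{v ∈ Y | pd v} / 2 ^ t) := by
  obtain ⟨j₀, hj₀, hne⟩ : ∃ j₀ < t, blk (T.l j₀) (T.lam j₀) s ≠ blk (T.l j₀) (T.lam j₀) s' := by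
    by_contra! hcon
    have : ∀ j ≤ t, ∀ q < T.l j, s q = s' q := by
      intro j
      induction j with
      | zero => intro _ q hq; rw [T.l_zero] at hq; omega
      | succ j ih =>
        intro hj q hq
        by_cases hq' : q < T.l j
        · exact ih (by omega) q hq'
        · have h2 := T.l_succ j
          exact blk_eq_iff.1 (hcon j (by omega)) q (by omega) (by omega)
    obtain ⟨q, hq, hq'⟩ := hs
    exact hq' (this t le_rfl q hq)
  set φ : (j : ℕ) → (Fin (T.D j) → Bool) → ℝ := fun j u =>
    if T.E j (blk (T.l j) (T.lam j) s) u = c j ∧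
      (j = j₀ → T.E j (blk (T.l j) (T.lam j) s') u = c j) then 1 else 0 with hφ
  have key := hY.sum_mul_prod (Nat.zero_le t) (fun j _ => T.m_succ j) hmn
    (fun v => if pd v then 1 else 0) (fun x hx y hy h => by simp only [hpd x hx y hy h]) φ
  have bound : ∀ j ∈ Ico 0 t, (∑ u, φ j u) / 2 ^ T.D j ≤ 1 / 2 * if j = j₀ then 7 / 8 else 1 := by
    intro j _
    have h1 := (T.good j).row_balanced (blk (T.l j) (T.lam j) s) (c j)
    rw [Fintype.card_fun, Fintype.card_bool, Fintype.card_fin, ← Nat.cast_inj (R := ℝ)] at h1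
    push_cast at h1
    rw [div_le_iff₀ (by positivity)]
    simp only [hφ]
    split_ifs with hj
    · subst hj
      have h2 := (T.good j).row_dist _ _ hne (c j)
      rw [Fintype.card_fun, Fintype.card_bool, Fintype.card_fin, ← Nat.cast_le (α := ℝ)] at h2
      push_cast at h2
      have h3 := card_filter_add_card_filter_not
        (s := univ.filter fun u => T.E j (blk (T.l j) (T.lam j) s) u = c j)
        (fun u => T.E j (blk (T.l j) (T.lam j) s') u = c j)
      rw [filter_filter, filter_filter, ← Nat.cast_inj (R := ℝ)] at h3
      push_cast at h3
      simp only [forall_const, sum_boole]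
      linarith
    · simp only [hj, false_imp_iff, and_true, sum_boole]
      linarith
  have prodbound : ∏ j ∈ Ico 0 t, (∑ u, φ j u) / 2 ^ T.D j ≤ (1 / 2) ^ t * (7 / 8) := by
    refine (prod_le_prod (fun j _ => ?_) bound).trans ?_
    · exact div_nonneg (sum_nonneg fun u _ => by simp only [hφ]; split_ifs <;> norm_num)
        (by positivity)
    · rw [prod_mul_distrib, prod_const, Nat.card_Ico, prod_ite_eq', if_pos (by simpa using hj₀)]
      simp
  calc (#{v ∈ Y | pd v ∧ T.Adj c 0 t s (b v) ∧ T.Adj c 0 t s' (b v)} : ℝ)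
      = ∑ v ∈ Y, if pd v ∧ T.Adj c 0 t s (b v) ∧ T.Adj c 0 t s' (b v) then 1 else 0 := by
        rw [sum_boole]
    _ ≤ ∑ v ∈ Y, (if pd v then 1 else 0) *
          ∏ j ∈ Ico 0 t, φ j (blk (T.m j) (T.D j) (b v)) := by
        refine sum_le_sum fun v _ => ?_
        split_ifs with h1 h2 h2
        · rw [one_mul, prod_eq_one]
          intro j hj
          simp only [hφ]
          rw [if_pos ⟨h1.2.1 j hj, fun _ => h1.2.2 j hj⟩]
        · exact absurd h1.1 h2
        · exact mul_nonneg zero_le_one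
            (prod_nonneg fun j _ => by simp only [hφ]; split_ifs <;> norm_num)
        · simp
    _ = #{v ∈ Y | pd v} * ∏ j ∈ Ico 0 t, (∑ u, φ j u) / 2 ^ T.D j := by rw [key, sum_boole]
    _ ≤ #{v ∈ Y | pd v} * ((1 / 2) ^ t * (7 / 8)) := by gcongr
    _ = _ := by rw [one_div_pow]; ring

end counts

end CodeTower

/-- No `n`-bit prefix is shared by a `1 - γ` proportion of the set `p`. -/
def IsSpread {α : Type*} (γ : ℝ) (a : α → ℕ → Bool) (n : ℕ) (p : Finset α) : Prop :=
  ∀ c : ℕ → Bool, (#{x ∈ p | ∀ i < n, a x i = c i} : ℝ) < (1 - γ) * #p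

open Classical in
/-- The parts `PX` refine the partition of `X` according to the first `n` bits of `a`, up to a
`γ`-fraction of `X` and of the remaining parts. -/
def ApproxRefines {α : Type*} (γ : ℝ) (X : Finset α) (PX : Finset (Finset α)) (a : α → ℕ → Bool)
    (n : ℕ) : Prop :=
  (∑ p ∈ PX with IsSpread γ a n p, #p : ℝ) ≤ γ * #X

namespace CodeTower

variable (T : CodeTower) {α β : Type*} {X : Finset α} {Y : Finset β} {a : α → ℕ → Bool}
  {b : β → ℕ → Bool}

/-- A spread set `p` has many edges to the vertices with at least `γ / 16 * |p|` non-neighbours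
in `p`. -/
theorem IsSpread.sum_card_adj_ge {n : ℕ} (hY : UnifBits Y b n) {i : ℕ} (hmn : T.m i ≤ n)
    (c : ℕ → Bool) (δ₀ : Bool) {γ : ℝ} (hγ0 : 0 < γ) (hγ : γ ≤ 1 / 2) {p : Finset α}
    (hp : IsSpread γ a (T.l i) p) :
    1 / 32 * (#p : ℝ) * (#{v ∈ Y | b v 0 = δ₀} / 2 ^ i) ≤
      ∑ x ∈ p, (#{v ∈ Y | (b v 0 = δ₀ ∧
        γ / 16 * (#p : ℝ) ≤ #{y ∈ p | ¬ T.Adj c 0 i (a y) (b v)}) ∧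
          T.Adj c 0 i (a x) (b v)} : ℝ) := by
  set U : ℝ := #{v ∈ Y | b v 0 = δ₀} / 2 ^ i with hU
  have hU0 : 0 ≤ U := by positivity
  set W : β → ℝ := fun v => #{y ∈ p | ¬ T.Adj c 0 i (a y) (b v)} with hW
  set N : α → Finset β := fun x => {v ∈ Y | b v 0 = δ₀ ∧ T.Adj c 0 i (a x) (b v)} with hN
  set g : α → ℝ := fun x => #{y ∈ p | ¬ ∀ q < T.l i, a y q = a x q} with hg
  set ND : α → ℝ := fun x => #{v ∈ Y | (b v 0 = δ₀ ∧ γ / 16 * (#p : ℝ) ≤ W v) ∧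
    T.Adj c 0 i (a x) (b v)} with hND
  have hpd : ∀ x ∈ Y, ∀ y ∈ Y, (∀ q < T.m 0, b x q = b y q) → (b x 0 = δ₀ ↔ b y 0 = δ₀) := by
    intro x _ y _ h
    rw [h 0 (by rw [T.m_zero]; exact one_pos)]
  have cardN (x : α) : (#(N x) : ℝ) = U := by
    have := T.card_adj hY hmn (Nat.zero_le i) c (a x) (fun v => b v 0 = δ₀) hpd
    rwa [Nat.sub_zero] at this
  have cardNN (x y : α) (h : ¬ ∀ q < T.l i, a y q = a x q) :
      U / 8 ≤ #{v ∈ N x | ¬ T.Adj c 0 i (a y) (b v)} := by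
    have h1 := T.card_adj_adj_le hY hmn (c := c) (s := a x) (s' := a y)
      (by push Not at h; obtain ⟨q, hq, hne⟩ := h; exact ⟨q, hq, hne.symm⟩)
      (fun v => b v 0 = δ₀) hpd
    have h2 := card_filter_add_card_filter_not (s := N x) fun v => T.Adj c 0 i (a y) (b v)
    have h3 : #{v ∈ N x | T.Adj c 0 i (a y) (b v)} = #{v ∈ Y | b v 0 = δ₀ ∧
        T.Adj c 0 i (a x) (b v) ∧ T.Adj c 0 i (a y) (b v)} := by
      simp only [hN, filter_filter, and_assoc]
    rw [h3, ← Nat.cast_inj (R := ℝ)] at h2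
    push_cast at h2
    rw [cardN] at h2
    linarith
  have sumW (x : α) : U / 8 * g x ≤ ∑ v ∈ N x, W v := by
    calc U / 8 * g x = ∑ y ∈ p with ¬ ∀ q < T.l i, a y q = a x q, U / 8 := by
          rw [sum_const, nsmul_eq_mul, mul_comm]
      _ ≤ ∑ y ∈ p with ¬ ∀ q < T.l i, a y q = a x q,
            (#{v ∈ N x | ¬ T.Adj c 0 i (a y) (b v)} : ℝ) :=
          sum_le_sum fun y hy => cardNN x y (mem_filter.1 hy).2
      _ ≤ ∑ y ∈ p, (#{v ∈ N x | ¬ T.Adj c 0 i (a y) (b v)} : ℝ) :=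
          sum_le_sum_of_subset_of_nonneg (filter_subset _ _) fun _ _ _ => Nat.cast_nonneg _
      _ = ∑ v ∈ N x, W v := by
          simp only [hW, ← sum_boole]
          exact sum_comm
  have heavy (x : α) (M : ℝ) (hM : 0 ≤ M) (hWM : ∀ v ∈ N x, W v ≤ M) :
      U / 8 * g x ≤ ND x * M + U * (γ / 16 * #p) := by
    refine (sumW x).trans ?_
    calc ∑ v ∈ N x, W v
        ≤ ∑ v ∈ N x, ((if γ / 16 * (#p : ℝ) ≤ W v then M else 0) + γ / 16 * #p) := by
          refine sum_le_sum fun v hv => ?_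
          split_ifs with h
          · have := hWM v hv
            have : 0 ≤ γ / 16 * (#p : ℝ) := by positivity
            linarith
          · push Not at h
            linarith
      _ = _ := by
          rw [sum_add_distrib, ← sum_filter, sum_const, sum_const, nsmul_eq_mul, nsmul_eq_mul,
            cardN]
          congr 4
          simp only [hN, filter_filter]
          congr 1
          ext v
          tauto
  have hWp (v : β) : W v ≤ #p := by
    simp only [hW]
    exact_mod_cast card_filter_le _ _
  by_cases hcase : ∀ x ∈ p, (#p : ℝ) / 2 ≤ g x
  · rw [mul_assoc, mul_comm (#p : ℝ), ← mul_assoc, mul_comm _ (#p : ℝ), ← nsmul_eq_mul, ← sum_const]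
    refine sum_le_sum fun x hx => ?_
    have h1 := heavy x #p (Nat.cast_nonneg _) fun v _ => hWp v
    have h2 := hcase x hx
    have hp0 : (0 : ℝ) < #p := by exact_mod_cast card_pos.2 ⟨x, hx⟩
    have h3 : U / 8 * (#p / 2) ≤ ND x * #p + U * (1 / 2 / 16 * #p) := by
      calc U / 8 * ((#p : ℝ) / 2) ≤ U / 8 * g x := by gcongr
        _ ≤ _ := h1
        _ ≤ _ := by gcongr
    have h4 : 1 / 32 * U * #p ≤ ND x * #p := by linarith
    exact le_of_mul_le_mul_right h4 hp0
  · push Not at hcase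
    obtain ⟨x₀, hx₀, hgx₀⟩ := hcase
    set Q := {y ∈ p | ∀ q < T.l i, a y q = a x₀ q} with hQ
    have hsplit : (#Q : ℝ) + g x₀ = #p := by
      simp only [hQ, hg]
      exact_mod_cast card_filter_add_card_filter_not (s := p) fun y => ∀ q < T.l i, a y q = a x₀ q
    have hspread := hp (a x₀)
    have hgγ : γ * #p < g x₀ := by
      have : (#Q : ℝ) < (1 - γ) * #p := hspread
      linarith
    have hg0 : 0 < g x₀ := lt_of_le_of_lt (by positivity) hgγ
    have each : ∀ x ∈ Q, U / 16 ≤ ND x := by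
      intro x hx
      have hxQ := (mem_filter.1 hx).2
      have hgx : g x = g x₀ := by
        simp only [hg]
        congr 2
        refine filter_congr fun y _ => not_congr (forall₂_congr fun q hq => ?_)
        rw [hxQ q hq]
      have hWM : ∀ v ∈ N x, W v ≤ g x₀ := by
        intro v hv
        simp only [hW, hg]
        refine Nat.cast_le.2 (card_le_card (monotone_filter_right _ fun y _ hy hy' => hy ?_))
        refine (mem_filter.1 hv).2.2.congr T (fun q hq => ?_) fun _ _ => rfl
        rw [hxQ q hq, hy' q hq]
      have h1 := heavy x (g x₀) hg0.le hWM
      rw [hgx] at h1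
      have h2 : U * (γ / 16 * #p) ≤ U * (g x₀ / 16) := by
        gcongr
        linarith
      have h4 : U / 16 * g x₀ ≤ ND x * g x₀ := by linarith
      exact le_of_mul_le_mul_right h4 hg0
    calc 1 / 32 * (#p : ℝ) * U ≤ #Q * (U / 16) := by
          have : (#p : ℝ) / 2 ≤ #Q := by linarith
          have := mul_le_mul_of_nonneg_right this (by positivity : 0 ≤ U / 16)
          linarith
      _ = ∑ x ∈ Q, U / 16 := by rw [sum_const, nsmul_eq_mul]
      _ ≤ ∑ x ∈ Q, ND x := sum_le_sum each
      _ ≤ ∑ x ∈ p, ND x :=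
          sum_le_sum_of_subset_of_nonneg (filter_subset _ _) fun _ _ _ => Nat.cast_nonneg _

/-- The bipartite graph given by codes with sparse collisions has no dense spots. -/
theorem sum_card_adj_le {nX nY : ℕ} (hX : UnifBits X a nX) (hY : UnifBits Y b nY) {i t : ℕ}
    (hit : i ≤ t) (hlX : T.l t ≤ nX) (hmY : T.m t ≤ nY) (c : ℕ → Bool) {L : Finset α}
    (hL : L ⊆ X) {B : Finset β} (hB : B ⊆ Y) {η θ : ℝ} (hθ : 0 ≤ θ)
    (hη : ∏ j ∈ Ico i t, (1 + ((2 : ℝ) ^ T.D j)⁻¹) ≤ 1 + η) (hηθ : η * #X ≤ θ ^ 2 * #L) :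
    ∑ x ∈ L, (#{v ∈ B | T.Adj c i t (a x) (b v)} : ℝ) ≤
      #L * (#B + θ * #Y) / 2 ^ (t - i) := by
  set r : ℝ := (2 ^ (t - i))⁻¹ with hr
  have hr0 : 0 ≤ r := by positivity
  set F : α → ℝ := fun x => #{v ∈ B | T.Adj c i t (a x) (b v)} with hF
  have hfx : ∀ x, F x = ∑ v ∈ B, if T.Adj c i t (a x) (b v) then 1 else 0 := fun x => by
    rw [sum_boole]
  have col (v : β) : (∑ x ∈ X, if T.Adj c i t (a x) (b v) then 1 else 0 : ℝ) = #X * r := by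
    have key := hX.sum_prod hit (fun j _ => T.l_succ j) hlX
      (fun j s => if T.E j s (blk (T.m j) (T.D j) (b v)) = c j then 1 else 0)
    have half : ∀ j ∈ Ico i t,
        (∑ s, if T.E j s (blk (T.m j) (T.D j) (b v)) = c j then 1 else 0 : ℝ) / 2 ^ T.lam j =
          1 / 2 := by
      intro j _
      have := (T.good j).col_balanced (blk (T.m j) (T.D j) (b v)) (c j)
      rw [Fintype.card_fun, Fintype.card_bool, Fintype.card_fin, ← Nat.cast_inj (R := ℝ)] at this
      push_cast at this
      rw [sum_boole, div_eq_div_iff (by positivity) (by positivity)]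
      linarith
    rw [prod_congr rfl half, prod_const, Nat.card_Ico, one_div, inv_pow] at key
    rw [hr, ← key]
    exact sum_congr rfl fun x _ => T.ind_adj c i t (a x) (b v)
  set K : β → β → ℝ := fun v v' =>
    ∏ j ∈ Ico i t, (1 + if blk (T.m j) (T.D j) (b v') = blk (T.m j) (T.D j) (b v) then 1 else 0)
    with hK
  have pair (v v' : β) : (∑ x ∈ X, (if T.Adj c i t (a x) (b v) then 1 else 0) *
      (if T.Adj c i t (a x) (b v') then 1 else 0) : ℝ) ≤ #X * (r ^ 2 * K v v') := by
    have key := hX.sum_prod hit (fun j _ => T.l_succ j) hlX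
      (fun j s => if T.E j s (blk (T.m j) (T.D j) (b v)) = c j ∧
        T.E j s (blk (T.m j) (T.D j) (b v')) = c j then 1 else 0)
    have bound : ∀ j ∈ Ico i t,
        (∑ s, if T.E j s (blk (T.m j) (T.D j) (b v)) = c j ∧
          T.E j s (blk (T.m j) (T.D j) (b v')) = c j then 1 else 0 : ℝ) / 2 ^ T.lam j ≤
          (1 / 2) ^ 2 *
            (1 + if blk (T.m j) (T.D j) (b v') = blk (T.m j) (T.D j) (b v) then 1 else 0) := by
      intro j _
      rw [div_le_iff₀ (by positivity), sum_boole]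
      split_ifs with h
      · have := (T.good j).col_balanced (blk (T.m j) (T.D j) (b v)) (c j)
        rw [Fintype.card_fun, Fintype.card_bool, Fintype.card_fin, ← Nat.cast_inj (R := ℝ)] at this
        push_cast at this
        rw [h]
        simp only [and_self]
        linarith
      · have := (T.good j).col_pair _ _ (Ne.symm h) (c j)
        rw [Fintype.card_fun, Fintype.card_bool, Fintype.card_fin, ← Nat.cast_le (α := ℝ)] at this
        push_cast at this
        linarith
    calc _ = ∑ x ∈ X, ∏ j ∈ Ico i t,
          (if T.E j (blk (T.l j) (T.lam j) (a x)) (blk (T.m j) (T.D j) (b v)) = c j ∧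
            T.E j (blk (T.l j) (T.lam j) (a x)) (blk (T.m j) (T.D j) (b v')) = c j
            then 1 else 0 : ℝ) := by
          refine sum_congr rfl fun x _ => ?_
          rw [T.ind_adj, T.ind_adj, ← prod_mul_distrib]
          refine prod_congr rfl fun j _ => ?_
          rw [ite_and, ite_mul, one_mul, zero_mul]
          rfl
      _ = _ := key
      _ ≤ #X * ∏ j ∈ Ico i t, ((1 / 2 : ℝ) ^ 2 *
            (1 + if blk (T.m j) (T.D j) (b v') = blk (T.m j) (T.D j) (b v) then 1 else 0)) := by
          refine mul_le_mul_of_nonneg_left (prod_le_prod (fun j _ => ?_) bound) (Nat.cast_nonneg _)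
          exact div_nonneg (sum_nonneg fun u _ => by split_ifs <;> norm_num) (by positivity)
      _ = #X * (r ^ 2 * K v v') := by
          rw [prod_mul_distrib, prod_const, Nat.card_Ico, ← pow_mul, mul_comm 2, pow_mul, hr,
            one_div, inv_pow]
  have Krow (v : β) : ∑ v' ∈ Y, K v v' ≤ #Y * (1 + η) := by
    have key := hY.sum_prod hit (fun j _ => T.m_succ j) hmY
      (fun j u => (1 + if u = blk (T.m j) (T.D j) (b v) then 1 else 0 : ℝ))
    simp only [hK]
    rw [key]
    refine mul_le_mul_of_nonneg_left (le_trans (le_of_eq ?_) hη) (Nat.cast_nonneg _)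
    refine prod_congr rfl fun j _ => ?_
    rw [sum_add_distrib, sum_ite_eq', if_pos (mem_univ _), sum_const, card_univ, Fintype.card_fun,
      Fintype.card_bool, Fintype.card_fin, nsmul_eq_mul, add_div]
    push_cast
    rw [mul_one, div_self (by positivity), one_div]
  have K1 (v v' : β) : 1 ≤ K v v' := by
    have : ∏ j ∈ Ico i t, (1 : ℝ) ≤ K v v' :=
      prod_le_prod (fun _ _ => zero_le_one) fun j _ => by split_ifs <;> norm_num
    simpa using this
  have KB : ∑ v ∈ B, ∑ v' ∈ B, (K v v' - 1) ≤ (#Y : ℝ) ^ 2 * η := by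
    calc ∑ v ∈ B, ∑ v' ∈ B, (K v v' - 1) ≤ ∑ v ∈ Y, ∑ v' ∈ Y, (K v v' - 1) := by
          refine (sum_le_sum fun v _ => sum_le_sum_of_subset_of_nonneg hB fun v' _ _ =>
            sub_nonneg.2 (K1 v v')).trans ?_
          exact sum_le_sum_of_subset_of_nonneg hB fun v _ _ =>
            sum_nonneg fun v' _ => sub_nonneg.2 (K1 v v')
      _ ≤ ∑ v ∈ Y, (#Y : ℝ) * η := by
          refine sum_le_sum fun v _ => ?_
          rw [sum_sub_distrib, sum_const, nsmul_eq_mul]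
          linarith [Krow v]
      _ = _ := by rw [sum_const, nsmul_eq_mul]; ring
  have first : ∑ x ∈ X, F x = #X * r * #B := by
    simp only [hfx]
    rw [sum_comm, sum_congr rfl fun v _ => col v, sum_const, nsmul_eq_mul, mul_comm]
  have second : ∑ x ∈ X, F x ^ 2 ≤ #X * r ^ 2 * ∑ v ∈ B, ∑ v' ∈ B, K v v' := by
    calc ∑ x ∈ X, F x ^ 2 = ∑ v ∈ B, ∑ v' ∈ B, ∑ x ∈ X,
          (if T.Adj c i t (a x) (b v) then 1 else 0) *
            (if T.Adj c i t (a x) (b v') then 1 else 0) := by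
          simp only [hfx, sq, sum_mul_sum]
          rw [sum_comm]
          exact sum_congr rfl fun v _ => sum_comm
      _ ≤ ∑ v ∈ B, ∑ v' ∈ B, #X * (r ^ 2 * K v v') :=
          sum_le_sum fun v _ => sum_le_sum fun v' _ => pair v v'
      _ = _ := by simp only [mul_sum, mul_assoc]
  have var : ∑ x ∈ X, (F x - r * #B) ^ 2 ≤ #X * r ^ 2 * ((#Y : ℝ) ^ 2 * η) := by
    have e1 : ∑ x ∈ X, (F x - r * #B) ^ 2 =
        ∑ x ∈ X, F x ^ 2 - 2 * (r * #B) * ∑ x ∈ X, F x + #X * (r * #B) ^ 2 := by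
      rw [mul_sum, ← nsmul_eq_mul, ← sum_const, ← sum_sub_distrib, ← sum_add_distrib]
      exact sum_congr rfl fun x _ => by ring
    have e2 : ∑ v ∈ B, ∑ v' ∈ B, (K v v' - 1) = (∑ v ∈ B, ∑ v' ∈ B, K v v') - (#B : ℝ) ^ 2 := by
      simp only [sum_sub_distrib, sum_const, nsmul_eq_mul]
      ring
    rw [e1, first]
    rw [e2] at KB
    have h3 := mul_le_mul_of_nonneg_left KB (by positivity : (0 : ℝ) ≤ #X * r ^ 2)
    linarith
  have cs : (∑ x ∈ L, (F x - r * #B)) ^ 2 ≤ (r * θ * #Y * #L) ^ 2 := by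
    calc (∑ x ∈ L, (F x - r * #B)) ^ 2 ≤ #L * ∑ x ∈ L, (F x - r * #B) ^ 2 :=
          sq_sum_le_card_mul_sum_sq
      _ ≤ #L * ∑ x ∈ X, (F x - r * #B) ^ 2 := by
          gcongr
      _ ≤ #L * (#X * r ^ 2 * ((#Y : ℝ) ^ 2 * η)) := by gcongr
      _ = #L * r ^ 2 * (#Y : ℝ) ^ 2 * (η * #X) := by ring
      _ ≤ #L * r ^ 2 * (#Y : ℝ) ^ 2 * (θ ^ 2 * #L) := by gcongr
      _ = _ := by ring
  have h4 := abs_le_of_sq_le_sq' cs (by positivity)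
  rw [sum_sub_distrib, sum_const, nsmul_eq_mul] at h4
  rw [div_eq_mul_inv, ← hr]
  linarith [h4.2]

end CodeTower

section Regular

variable {α β : Type*} [DecidableEq α] [DecidableEq β]

/-- A regular pair of `G'` with an empty rectangle in `G` requires many changes between `G` and
`G'`. -/
theorem BipRegular.card_symmDiff_ge {G G' : Finset (α × β)} {p p₀ : Finset α} {q q' : Finset β}
    {δ γ : ℝ} (hreg : BipRegular δ G' p q) (hγ0 : 0 ≤ γ) (hγ : γ ≤ 1 / 2) (hδγ : δ ≤ γ / 16)
    (hδ : δ ≤ 1 / 2) (hp₀ : p₀ ⊆ p) (hq' : q' ⊆ q) (hp₀c : γ / 16 * (#p : ℝ) ≤ #p₀)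
    (hq'c : 1 / 2 * (#q : ℝ) ≤ #q') (hemp : ∀ x ∈ p₀, ∀ v ∈ q', (x, v) ∉ G) :
    γ / 80 * (#(G ∩ p ×ˢ q) : ℝ) ≤ #(symmDiff G G' ∩ p ×ˢ q) := by
  rcases p.eq_empty_or_nonempty with rfl | hpne
  · simp
  rcases q.eq_empty_or_nonempty with rfl | hqne
  · simp
  have hp : (0 : ℝ) < #p := by exact_mod_cast card_pos.2 hpne
  have hq : (0 : ℝ) < #q := by exact_mod_cast card_pos.2 hqne
  have h := hreg p₀ hp₀ q' hq' ((by gcongr : δ * (#p : ℝ) ≤ γ / 16 * #p).trans hp₀c)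
    ((by gcongr : δ * (#q : ℝ) ≤ 1 / 2 * #q).trans hq'c)
  unfold bipDensity at h
  set e : ℝ := ((#(G' ∩ p ×ˢ q) : ℕ) : ℝ) with he
  set e' : ℝ := ((#(G' ∩ p₀ ×ˢ q') : ℕ) : ℝ) with he'
  set g : ℝ := ((#(G ∩ p ×ˢ q) : ℕ) : ℝ) with hg
  set s : ℝ := ((#(symmDiff G G' ∩ p ×ˢ q) : ℕ) : ℝ) with hs
  have he0 : 0 ≤ e := Nat.cast_nonneg _
  have h1 : γ / 64 * e ≤ e' := by
    rcases hγ0.eq_or_lt with rfl | hγ0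
    · simp [he']
    have hp₀' : (0 : ℝ) < #p₀ := lt_of_lt_of_le (by positivity) hp₀c
    have hq'' : (0 : ℝ) < #q' := lt_of_lt_of_le (by positivity) hq'c
    rw [le_div_iff₀ (by positivity)] at h
    refine le_trans ?_ h
    calc γ / 64 * e = 1 / 2 * (e / (#p * #q)) * ((γ / 16 * #p) * (1 / 2 * #q)) := by
          field_simp
          ring
      _ ≤ _ := by gcongr
  have h2 : e' ≤ s := by
    simp only [he', hs]
    refine Nat.cast_le.2 (card_le_card fun z hz => ?_)
    rw [mem_inter, mem_product] at hz
    rw [mem_inter, mem_product, mem_symmDiff]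
    exact ⟨Or.inr ⟨hz.1, hemp _ hz.2.1 _ hz.2.2⟩, hp₀ hz.2.1, hq' hz.2.2⟩
  have h3 : g ≤ e + s := by
    simp only [hg, he, hs]
    norm_cast
    refine (card_le_card fun z hz => ?_).trans (card_union_le _ _)
    rw [mem_union, mem_inter, mem_inter, mem_symmDiff]
    rw [mem_inter] at hz
    by_cases hz' : z ∈ G'
    · exact Or.inl ⟨hz', hz.2⟩
    · exact Or.inr ⟨Or.inl ⟨hz.1, hz'⟩, hz.2⟩
  have hs0 : 0 ≤ s := Nat.cast_nonneg _
  nlinarith [mul_le_mul_of_nonneg_left h3 hγ0, mul_le_mul_of_nonneg_right hγ hs0]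

theorem sum_card_inter_product_le (S : Finset (α × β)) {PX : Finset (Finset α)}
    {PY : Finset (Finset β)} (hX : (PX : Set (Finset α)).PairwiseDisjoint id)
    (hY : (PY : Set (Finset β)).PairwiseDisjoint id) :
    ∑ p ∈ PX, ∑ q ∈ PY, #(S ∩ p ×ˢ q) ≤ #S := by
  rw [← sum_product', ← card_biUnion]
  · exact card_le_card (biUnion_subset.2 fun _ _ => inter_subset_left)
  · rintro ⟨p, q⟩ hpq ⟨p', q'⟩ hpq' hne
    rw [mem_coe, mem_product] at hpq hpq'
    refine disjoint_left.2 fun z hz hz' => hne ?_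
    rw [mem_inter, mem_product] at hz hz'
    have h1 : p = p' := hX.elim hpq.1 hpq'.1 (not_disjoint_iff.2 ⟨z.1, hz.2.1, hz'.2.1⟩)
    have h2 : q = q' := hY.elim hpq.2 hpq'.2 (not_disjoint_iff.2 ⟨z.2, hz.2.2, hz'.2.2⟩)
    rw [h1, h2]

end Regular

open Classical in
/-- The points outside the majority cell of their part are few. -/
theorem ApproxRefines.exists_misplaced {β : Type*} {Y : Finset β} {PY : Finset (Finset β)}
    {b : β → ℕ → Bool} {n : ℕ} {ε : ℝ} (h : ApproxRefines ε Y PY b n) (hε : 0 ≤ ε)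
    (hsub : ∀ q ∈ PY, q ⊆ Y) (hdisj : (PY : Set (Finset β)).PairwiseDisjoint id)
    (hcover : ∀ v ∈ Y, ∃ q ∈ PY, v ∈ q) :
    ∃ (B : Finset β) (cell : Finset β → ℕ → Bool), B ⊆ Y ∧ (#B : ℝ) ≤ 2 * ε * #Y ∧
      ∀ v ∈ Y, v ∉ B → ∃ q ∈ PY, v ∈ q ∧ (∀ l < n, b v l = cell q l) ∧
        (1 - ε) * (#q : ℝ) ≤ #{w ∈ q | ∀ l < n, b w l = cell q l} := by
  have hch : ∀ q : Finset β, ∃ c : ℕ → Bool, ¬ IsSpread ε b n q →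
      (1 - ε) * (#q : ℝ) ≤ #{w ∈ q | ∀ l < n, b w l = c l} := by
    intro q
    by_cases hq : IsSpread ε b n q
    · exact ⟨fun _ => false, fun h => absurd hq h⟩
    · unfold IsSpread at hq
      push Not at hq
      obtain ⟨c, hc⟩ := hq
      exact ⟨c, fun _ => hc⟩
  choose cell hcell using hch
  set bad : Finset β → Finset β := fun q =>
    if IsSpread ε b n q then q else {w ∈ q | ¬ ∀ l < n, b w l = cell q l} with hbad
  have hbadsub (q) : bad q ⊆ q := by
    simp only [hbad]
    split_ifs
    · exact Subset.rfl
    · exact filter_subset _ _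
  refine ⟨PY.biUnion bad, cell, biUnion_subset.2 fun q hq => (hbadsub q).trans (hsub q hq), ?_, ?_⟩
  · have hcard : (∑ q ∈ PY, (#q : ℝ)) ≤ #Y := by
      rw [← Nat.cast_sum]
      have := card_biUnion (s := PY) (t := id) fun q hq q' hq' hne => hdisj hq hq' hne
      simp only [id] at this
      rw [← this]
      exact_mod_cast card_le_card (biUnion_subset.2 fun q hq => hsub q hq)
    have hq : ∀ q ∈ PY, (#(bad q) : ℝ) ≤ (if IsSpread ε b n q then (#q : ℝ) else 0) + ε * #q := by
      intro q _
      simp only [hbad]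
      split_ifs with hs
      · have : 0 ≤ ε * (#q : ℝ) := by positivity
        linarith
      · have h1 := hcell q hs
        have h2 := card_filter_add_card_filter_not (s := q) fun w => ∀ l < n, b w l = cell q l
        rw [← Nat.cast_inj (R := ℝ)] at h2
        push_cast at h2
        linarith
    calc (#(PY.biUnion bad) : ℝ) ≤ ∑ q ∈ PY, (#(bad q) : ℝ) := by exact_mod_cast card_biUnion_le
      _ ≤ ∑ q ∈ PY, ((if IsSpread ε b n q then (#q : ℝ) else 0) + ε * #q) := sum_le_sum hq
      _ = (∑ q ∈ PY with IsSpread ε b n q, (#q : ℝ)) + ε * ∑ q ∈ PY, (#q : ℝ) := by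
          rw [sum_add_distrib, sum_filter, mul_sum]
      _ ≤ ε * #Y + ε * #Y := by
          have h' : (∑ q ∈ PY with IsSpread ε b n q, (#q : ℝ)) ≤ ε * #Y := h
          gcongr
      _ = 2 * ε * #Y := by ring
  · intro v hv hvB
    obtain ⟨q, hq, hvq⟩ := hcover v hv
    have hvbad : v ∉ bad q := fun hmem => hvB (mem_biUnion.2 ⟨q, hq, hmem⟩)
    simp only [hbad] at hvbad
    split_ifs at hvbad with hs
    · exact absurd hvq hvbad
    · rw [mem_filter, not_and, not_not] at hvbad
      exact ⟨q, hq, hvq, hvbad hvq, hcell q hs⟩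

namespace CodeTower

variable (T : CodeTower) {α β : Type*} [DecidableEq α] [DecidableEq β] {X : Finset α} {Y : Finset β}
  {a : α → ℕ → Bool} {b : β → ℕ → Bool}

set_option maxHeartbeats 1000000 in
/-- In a regular partition of a graph defined by codes, a refined partition of one side forces a
much more refined partition of the other side. -/
theorem approxRefines_of_bipRegularPartition {nX nY : ℕ} (hX : UnifBits X a nX)
    (hY : UnifBits Y b nY) (hYne : Y.Nonempty) {i t T₀ : ℕ} (hit : i ≤ t) (hlX : T.l t ≤ nX)
    (hmY : T.m t ≤ nY) {c : ℕ → Bool} {d : α → Bool} {G : Finset (α × β)}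
    (hG : ∀ x ∈ X, ∀ v ∈ Y, b v 0 = d x → ((x, v) ∈ G ↔ T.Adj c 0 t (a x) (b v)))
    (hGcard : (#G : ℝ) ≤ #X * #Y / 2 ^ t) {PX : Finset (Finset α)} {PY : Finset (Finset β)}
    (hPX : ∀ p ∈ PX, p ⊆ X) (hPXdisj : (PX : Set (Finset α)).PairwiseDisjoint id)
    (hPXd : ∀ p ∈ PX, ∀ x ∈ p, ∀ y ∈ p, d x = d y) (hPY : ∀ q ∈ PY, q ⊆ Y)
    (hPYdisj : (PY : Set (Finset β)).PairwiseDisjoint id) (hPYcover : ∀ v ∈ Y, ∃ q ∈ PY, v ∈ q)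
    {δ γ ε θ η : ℝ} (hreg : BipRegularPartition δ X Y G PX PY) (hγ0 : 0 < γ) (hγ : γ ≤ 1 / 2)
    (hδ : δ ≤ γ ^ 2 / 2 ^ 14) (hε : 0 ≤ ε) (hθ : 0 ≤ θ)
    (hη : T₀ ≤ t → ∏ j ∈ Ico T₀ t, (1 + ((2 : ℝ) ^ T.D j)⁻¹) ≤ 1 + η) (hηθ : η ≤ θ ^ 2 * γ)
    (hsmall : 2 ^ T₀ * (2 * ε + θ) ≤ 1 / 128) (href : ApproxRefines ε Y PY b (T.m i)) :
    ApproxRefines γ X PX a (T.l i) := by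
  classical
  by_contra hcon
  unfold ApproxRefines at hcon
  push Not at hcon
  set PB := PX.filter (IsSpread γ a (T.l i)) with hPB
  set L := PB.biUnion id with hLdef
  have hPBsub : PB ⊆ PX := filter_subset _ _
  have hPBdisj : (PB : Set (Finset α)).PairwiseDisjoint id :=
    hPXdisj.subset (by exact_mod_cast hPBsub)
  have sumL (f : α → ℝ) : ∑ x ∈ L, f x = ∑ p ∈ PB, ∑ x ∈ p, f x := by
    rw [hLdef, sum_biUnion hPBdisj]
    rfl
  have hLcard : γ * #X < #L := by
    have := sumL fun _ => 1
    simp only [sum_const, nsmul_eq_mul, mul_one] at this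
    rwa [this]
  have hLX : L ⊆ X := biUnion_subset.2 fun p hp => hPX p (hPBsub hp)
  obtain ⟨B, cell, hBY, hBcard, hB⟩ := href.exists_misplaced hε hPY hPYdisj hPYcover
  have hYpos : (0 : ℝ) < #Y := by exact_mod_cast card_pos.2 hYne
  have hLpos : (0 : ℝ) < #L := lt_of_le_of_lt (by positivity) hLcard
  -- few edges go to misplaced vertices
  have few : ∑ x ∈ L, (#{v ∈ B | T.Adj c 0 t (a x) (b v)} : ℝ) ≤ #L * #Y / 2 ^ t / 128 := by
    have hB2 : (#B : ℝ) + θ * #Y ≤ (2 * ε + θ) * #Y := by linarith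
    rcases le_or_gt T₀ t with h0 | h0
    · have key := T.sum_card_adj_le hX hY h0 hlX hmY c hLX hBY hθ (hη h0) (by
        calc η * #X ≤ θ ^ 2 * γ * #X := by gcongr
          _ = θ ^ 2 * (γ * #X) := by ring
          _ ≤ θ ^ 2 * #L := by gcongr)
      calc ∑ x ∈ L, (#{v ∈ B | T.Adj c 0 t (a x) (b v)} : ℝ)
          ≤ ∑ x ∈ L, (#{v ∈ B | T.Adj c T₀ t (a x) (b v)} : ℝ) := by
            refine sum_le_sum fun x _ => Nat.cast_le.2 (card_le_card ?_)
            exact monotone_filter_right _ fun v _ hv => ((T.adj_split h0).1 hv).2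
        _ ≤ #L * (#B + θ * #Y) / 2 ^ (t - T₀) := key
        _ ≤ #L * ((2 * ε + θ) * #Y) / 2 ^ (t - T₀) := by gcongr
        _ = #L * #Y / 2 ^ t * (2 ^ T₀ * (2 * ε + θ)) := by
            have : (2 : ℝ) ^ t = 2 ^ (t - T₀) * 2 ^ T₀ := by rw [← pow_add, Nat.sub_add_cancel h0]
            rw [this]
            field_simp
        _ ≤ #L * #Y / 2 ^ t * (1 / 128) := by gcongr
        _ = _ := by ring
    · calc ∑ x ∈ L, (#{v ∈ B | T.Adj c 0 t (a x) (b v)} : ℝ) ≤ ∑ x ∈ L, (#B : ℝ) :=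
            sum_le_sum fun x _ => Nat.cast_le.2 (card_filter_le _ _)
        _ = #L * #B := by rw [sum_const, nsmul_eq_mul]
        _ ≤ #L * ((2 * ε + θ) * #Y) := by
            gcongr
            linarith [mul_nonneg hθ hYpos.le]
        _ = #L * #Y / 2 ^ t * (2 ^ t * (2 * ε + θ)) := by field_simp
        _ ≤ #L * #Y / 2 ^ t * (2 ^ T₀ * (2 * ε + θ)) := by gcongr; norm_num
        _ ≤ #L * #Y / 2 ^ t * (1 / 128) := by gcongr
        _ = _ := by ring
  have hε2 : ε ≤ 1 / 2 := by
    have h1 : (1 : ℝ) ≤ 2 ^ T₀ := one_le_pow₀ (by norm_num)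
    have h2 : 1 * (2 * ε + θ) ≤ 2 ^ T₀ * (2 * ε + θ) := by gcongr
    linarith
  obtain ⟨G', _, hGG', hG'reg⟩ := hreg
  -- each spread part requires many changes
  have each : ∀ p ∈ PB, γ / 80 * (1 / 64 * #p * #Y / 2 ^ t -
      ∑ x ∈ p, (#{v ∈ B | T.Adj c 0 t (a x) (b v)} : ℝ)) ≤
        ∑ q ∈ PY, (#(symmDiff G G' ∩ p ×ˢ q) : ℝ) := by
    intro p hp
    have hpX := hPX p (hPBsub hp)
    have hspread := (mem_filter.1 hp).2
    obtain ⟨δ₀, hδ₀⟩ : ∃ δ₀, ∀ x ∈ p, d x = δ₀ := by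
      rcases p.eq_empty_or_nonempty with rfl | ⟨y, hy⟩
      · exact ⟨false, by simp⟩
      · exact ⟨d y, fun x hx => hPXd p (hPBsub hp) x hx y hy⟩
    set heavy : β → Prop := fun v => b v 0 = δ₀ ∧
      γ / 16 * (#p : ℝ) ≤ #{y ∈ p | ¬ T.Adj c 0 i (a y) (b v)} with hheavy
    have hheavyc : ∀ v w, (∀ q < T.m i, b v q = b w q) → heavy v → heavy w := by
      intro v w hvw hv
      refine ⟨by rw [← hvw 0 (T.one_le_m i)]; exact hv.1, hv.2.trans (Nat.cast_le.2 ?_)⟩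
      refine card_le_card (monotone_filter_right _ fun y _ hy hy' => hy ?_)
      exact hy'.congr T (fun _ _ => rfl) fun q hq => (hvw q hq).symm
    have claim := IsSpread.sum_card_adj_ge T hY ((T.m_mono hit).trans hmY) c δ₀ hγ0 hγ hspread
    have half : (#{v ∈ Y | b v 0 = δ₀} : ℝ) = #Y / 2 := by
      have h1 := (hY.mono ((T.one_le_m t).trans hmY)).card_eq fun _ => δ₀
      simpa using h1
    have up (x : α) : (#{v ∈ Y | heavy v ∧ T.Adj c 0 t (a x) (b v)} : ℝ) =
        #{v ∈ Y | heavy v ∧ T.Adj c 0 i (a x) (b v)} / 2 ^ (t - i) := by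
      rw [← T.card_adj hY hmY hit c (a x) (fun v => heavy v ∧ T.Adj c 0 i (a x) (b v))]
      · simp only [T.adj_split hit, and_assoc]
      · intro v _ w _ hvw
        exact ⟨fun h => ⟨hheavyc v w hvw h.1, h.2.congr T (fun _ _ => rfl) hvw⟩,
          fun h => ⟨hheavyc w v (fun q hq => (hvw q hq).symm) h.1,
            h.2.congr T (fun _ _ => rfl) fun q hq => (hvw q hq).symm⟩⟩
    have many : 1 / 64 * #p * #Y / 2 ^ t ≤
        ∑ x ∈ p, (#{v ∈ Y | heavy v ∧ T.Adj c 0 t (a x) (b v)} : ℝ) := by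
      simp only [up]
      rw [← sum_div, le_div_iff₀ (by positivity)]
      refine le_trans (le_of_eq ?_) claim
      rw [half]
      have : (2 : ℝ) ^ t = 2 ^ (t - i) * 2 ^ i := by rw [← pow_add, Nat.sub_add_cancel hit]
      rw [this]
      field_simp
      ring
    set Q := PY.filter fun q => (∃ v ∈ q, heavy v ∧ ∀ l < T.m i, b v l = cell q l) ∧
      (1 - ε) * (#q : ℝ) ≤ #{w ∈ q | ∀ l < T.m i, b w l = cell q l} with hQ
    have cover : ∑ x ∈ p, (#{v ∈ Y | heavy v ∧ T.Adj c 0 t (a x) (b v)} : ℝ) ≤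
        (∑ x ∈ p, (#{v ∈ B | T.Adj c 0 t (a x) (b v)} : ℝ)) +
          ∑ q ∈ Q, (#(G ∩ p ×ˢ q) : ℝ) := by
      have hE (q) (hq : q ⊆ Y) : (∑ x ∈ p, (#{v ∈ q | b v 0 = δ₀ ∧ T.Adj c 0 t (a x) (b v)} : ℝ)) ≤
          #(G ∩ p ×ˢ q) := by
        rw [← Nat.cast_sum, ← card_sigma]
        refine Nat.cast_le.2 (card_le_card_of_injOn (fun z => (z.1, z.2)) ?_ ?_)
        · rintro ⟨x, v⟩ hz
          simp only [coe_sigma, Set.mem_sigma_iff, mem_coe, mem_filter] at hz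
          simp only [mem_coe, mem_inter, mem_product]
          exact ⟨(hG x (hpX hz.1) v (hq hz.2.1) (by rw [hz.2.2.1, hδ₀ x hz.1])).2 hz.2.2.2, hz.1,
            hz.2.1⟩
        · rintro ⟨x, v⟩ _ ⟨x', v'⟩ _ hxy
          simp only [Prod.mk.injEq] at hxy
          rw [hxy.1, hxy.2]
      calc _ ≤ ∑ x ∈ p, ((#{v ∈ B | T.Adj c 0 t (a x) (b v)} : ℝ) +
            ∑ q ∈ Q, (#{v ∈ q | b v 0 = δ₀ ∧ T.Adj c 0 t (a x) (b v)} : ℝ)) := by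
            refine sum_le_sum fun x _ => ?_
            norm_cast
            refine (card_le_card fun v hv => ?_).trans
              ((card_union_le _ (Q.biUnion fun q => {v ∈ q | b v 0 = δ₀ ∧
                T.Adj c 0 t (a x) (b v)})).trans (Nat.add_le_add_left card_biUnion_le _))
            rw [mem_filter] at hv
            rw [mem_union, mem_filter]
            by_cases hvB : v ∈ B
            · exact Or.inl ⟨hvB, hv.2.2⟩
            · obtain ⟨q, hq, hvq, hcell, hcard⟩ := hB v hv.1 hvB
              exact Or.inr (mem_biUnion.2 ⟨q, mem_filter.2 ⟨hq, ⟨v, hvq, hv.2.1, hcell⟩, hcard⟩,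
                mem_filter.2 ⟨hvq, hv.2.1.1, hv.2.2⟩⟩)
        _ = _ := by rw [sum_add_distrib, sum_comm (s := p) (t := Q)]
        _ ≤ _ := by
            gcongr with q hq
            exact hE q (hPY q (mem_filter.1 hq).1)
    have rect : ∀ q ∈ Q, γ / 80 * (#(G ∩ p ×ˢ q) : ℝ) ≤ #(symmDiff G G' ∩ p ×ˢ q) := by
      intro q hq
      obtain ⟨hqP, ⟨v, hvq, hv, hvc⟩, hqcard⟩ := mem_filter.1 hq
      refine (hG'reg p (hPBsub hp) q hqP).card_symmDiff_ge hγ0.le hγ ?_ ?_ (filter_subset _ _)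
        (filter_subset (fun w => ∀ l < T.m i, b w l = cell q l) _) hv.2 ?_ ?_
      · nlinarith
      · nlinarith
      · refine le_trans ?_ hqcard
        gcongr
        linarith
      · intro x hx w hw hmem
        rw [mem_filter] at hx hw
        have hwv : ∀ l < T.m i, b w l = b v l := fun l hl => by rw [hw.2 l hl, hvc l hl]
        have hd : b w 0 = d x := by rw [hwv 0 (T.one_le_m i), hv.1, hδ₀ x hx.1]
        have hadj := (hG x (hpX hx.1) w (hPY q hqP hw.1) hd).1 hmem
        exact hx.2 (((T.adj_split hit).1 hadj).1.congr T (fun _ _ => rfl) hwv)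
    calc _ ≤ γ / 80 * ∑ q ∈ Q, (#(G ∩ p ×ˢ q) : ℝ) := by
          gcongr
          linarith
      _ = ∑ q ∈ Q, γ / 80 * (#(G ∩ p ×ˢ q) : ℝ) := by rw [mul_sum]
      _ ≤ ∑ q ∈ Q, (#(symmDiff G G' ∩ p ×ˢ q) : ℝ) := sum_le_sum rect
      _ ≤ _ := sum_le_sum_of_subset_of_nonneg (filter_subset _ _) fun _ _ _ => Nat.cast_nonneg _
  have total : γ / 80 * (#L * #Y / 2 ^ t / 128) ≤ δ * #G := by
    calc γ / 80 * (#L * #Y / 2 ^ t / 128)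
        ≤ γ / 80 * (1 / 64 * #L * #Y / 2 ^ t -
            ∑ x ∈ L, (#{v ∈ B | T.Adj c 0 t (a x) (b v)} : ℝ)) := by
          gcongr
          have e : (1 : ℝ) / 64 * #L * #Y / 2 ^ t = 2 * (#L * #Y / 2 ^ t / 128) := by ring
          linarith
      _ = ∑ p ∈ PB, γ / 80 * (1 / 64 * #p * #Y / 2 ^ t -
            ∑ x ∈ p, (#{v ∈ B | T.Adj c 0 t (a x) (b v)} : ℝ)) := by
          rw [← mul_sum, sum_sub_distrib, sumL]
          congr 2
          have := sumL fun _ => 1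
          simp only [sum_const, nsmul_eq_mul, mul_one] at this
          rw [this, mul_sum, sum_mul, sum_div]
      _ ≤ ∑ p ∈ PB, ∑ q ∈ PY, (#(symmDiff G G' ∩ p ×ˢ q) : ℝ) := sum_le_sum each
      _ ≤ #(symmDiff G G') := by
          exact_mod_cast sum_card_inter_product_le (symmDiff G G') hPBdisj hPYdisj
      _ ≤ _ := hGG'
  have hXpos : (0 : ℝ) < #X := lt_of_lt_of_le hLpos (by exact_mod_cast card_le_card hLX)
  set w : ℝ := #Y / 2 ^ t with hw
  have hwpos : 0 < w := by positivity
  have h1 : δ * (#G : ℝ) ≤ γ ^ 2 / 2 ^ 14 * (#X * w) := by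
    calc δ * (#G : ℝ) ≤ γ ^ 2 / 2 ^ 14 * #G := by gcongr
      _ ≤ γ ^ 2 / 2 ^ 14 * (#X * w) := by
        gcongr
        rw [hw]
        exact hGcard.trans (le_of_eq (by ring))
  have h2 : γ / 80 * (γ * #X * w / 128) < γ / 80 * (#L * #Y / 2 ^ t / 128) := by
    have : (#L : ℝ) * #Y / 2 ^ t = #L * w := by rw [hw]; ring
    rw [this]
    gcongr
  have h3 : 0 < γ ^ 2 * (#X * w) := by positivity
  nlinarith

end CodeTower

/-- A good code of length `2 ^ d`, when `8 ≤ d`. -/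
noncomputable def chosenCode (d : ℕ) : (Fin (2 ^ (d - 4)) → Bool) → (Fin d → Bool) → Bool :=
  open Classical in if h : 8 ≤ d then (exists_goodCode d h).choose else fun _ _ => false

theorem goodCode_chosenCode {d : ℕ} (h : 8 ≤ d) : GoodCode (chosenCode d) := by
  rw [chosenCode, dif_pos h]
  exact (exists_goodCode d h).choose_spec

/-- The triples `(m j, m (j + 1), l j)` of positions of windows, when the windows of the first bit
sequence determine `f` bits of the second one. -/
def levels (f : ℕ → ℕ) : ℕ → ℕ × ℕ × ℕ
  | 0 => (1, 100, 0)
  | j + 1 =>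
    ((levels f j).2.1, f ((levels f j).2.2 + 2 ^ ((levels f j).2.1 - (levels f j).1 - 4)),
      (levels f j).2.2 + 2 ^ ((levels f j).2.1 - (levels f j).1 - 4))

/-- `growth r t` is the number of bits of the vertices which are determined by the first `t` bits of
the edges with `r + 1` vertices. -/
def growth : ℕ → ℕ → ℕ
  | 0 => id
  | r + 1 => fun t => (levels (growth r) t).2.1

theorem eight_mul_le_two_pow {n : ℕ} (hn : 50 ≤ n) : 8 * n ≤ 2 ^ (n - 4) := by
  induction n, hn using Nat.le_induction with
  | base => norm_num
  | succ n hn ih =>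
    rw [show n + 1 - 4 = n - 4 + 1 by omega, pow_succ]
    omega

theorem levels_spec {f : ℕ → ℕ} (hf : ∀ n, n ≤ f n) (j : ℕ) :
    2 * (levels f j).1 ≤ (levels f j).2.1 ∧ 100 ≤ (levels f j).2.1 ∧
      2 ^ (j + 6) ≤ (levels f j).2.1 - (levels f j).1 := by
  induction j with
  | zero => simp [levels]
  | succ j ih =>
    obtain ⟨h1, h2, h3⟩ := ih
    simp only [levels]
    set m := (levels f j).1
    set m' := (levels f j).2.1
    set l := (levels f j).2.2
    have h4 := hf (l + 2 ^ (m' - m - 4))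
    have h5 := eight_mul_le_two_pow (n := m' - m) (by omega)
    have h6 : 2 ^ (j + 1 + 6) = 2 * 2 ^ (j + 6) := by rw [show j + 1 + 6 = j + 6 + 1 by ring, pow_succ,
      mul_comm]
    omega

theorem le_growth (r n : ℕ) : n ≤ growth r n := by
  induction r generalizing n with
  | zero => exact le_rfl
  | succ r ih =>
    have h := (levels_spec ih n).2.2
    have h2 : n < 2 ^ n := Nat.lt_two_pow_self
    have h3 : 2 ^ n ≤ 2 ^ (n + 6) := Nat.pow_le_pow_right (by norm_num) (by omega)
    simp only [growth]
    omega

/-- The codes used for edges with `r + 2` vertices. -/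
noncomputable def tower (r : ℕ) : CodeTower where
  m j := (levels (growth r) j).1
  D j := (levels (growth r) j).2.1 - (levels (growth r) j).1
  l j := (levels (growth r) j).2.2
  lam j := 2 ^ ((levels (growth r) j).2.1 - (levels (growth r) j).1 - 4)
  E j := chosenCode _
  m_zero := rfl
  l_zero := rfl
  m_succ j := by
    have := levels_spec (le_growth r) j
    simp only [levels]
    omega
  l_succ j := rfl
  good j := goodCode_chosenCode (by
    have := levels_spec (le_growth r) j
    omega)

theorem tower_m_one (r : ℕ) : (tower r).m 1 = 100 := rfl

theorem tower_m_succ_succ (r j : ℕ) : (tower r).m (j + 2) = growth r ((tower r).l (j + 1)) := rfl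

theorem growth_succ (r t : ℕ) : growth (r + 1) t = (tower r).m (t + 1) := rfl

theorem two_pow_le_tower_D (r j : ℕ) : 2 ^ (j + 6) ≤ (tower r).D j :=
  (levels_spec (le_growth r) j).2.2

theorem half_m_le_tower_D (r j : ℕ) : (tower r).m (j + 1) ≤ 2 * (tower r).D j := by
  have := (levels_spec (le_growth r) j).1
  simp only [tower, levels]
  omega

theorem two_pow_le_tower_l (r j : ℕ) : 2 ^ ((tower r).D j - 4) ≤ (tower r).l (j + 1) :=
  Nat.le_add_left _ _

/-- The number of bits per vertex which are used by the first `t` bits of edges with `r + 1`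
vertices. -/
noncomputable def bitsNeeded : ℕ → ℕ → ℕ
  | 0 => id
  | r + 1 => fun t => max ((tower r).m (t + 1)) (bitsNeeded r ((tower r).l t))

theorem bitsNeeded_mono (r : ℕ) : Monotone (bitsNeeded r) := by
  induction r with
  | zero => exact monotone_id
  | succ r ih =>
    intro a b hab
    exact max_le_max ((tower r).m_mono (by omega)) (ih ((tower r).l_mono hab))

theorem growth_le_bitsNeeded (r t : ℕ) : growth r t ≤ bitsNeeded r t := by
  cases r with
  | zero => exact le_rfl
  | succ r => exact le_max_left _ _

theorem succ_le_Ack (k n : ℕ) : n + 1 ≤ Ack (k + 1) n := by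
  induction k generalizing n with
  | zero => exact Nat.lt_two_pow_self
  | succ k ih =>
    simp only [Ack]
    induction n with
    | zero => simp
    | succ n ihn =>
      rw [Function.iterate_succ_apply']
      have := ih ((Ack (k + 1))^[n] 1)
      omega

theorem Ack_add_two_succ (k n : ℕ) : Ack (k + 2) (n + 1) = Ack (k + 1) (Ack (k + 2) n) := by
  simp only [Ack]
  rw [Function.iterate_succ_apply']

theorem Ack_mono (k : ℕ) : Monotone (Ack (k + 1)) := by
  cases k with
  | zero => exact fun a b hab => Nat.pow_le_pow_right (by norm_num) hab
  | succ k =>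
    refine monotone_nat_of_le_succ fun n => ?_
    rw [Ack_add_two_succ]
    exact (Nat.le_succ _).trans (succ_le_Ack k _)

theorem two_mul_Ack_le_growth (r t : ℕ) : 2 * Ack (r + 2) t + 20 ≤ growth (r + 1) t := by
  induction r generalizing t with
  | zero =>
    induction t with
    | zero => simp [Ack, growth, levels]
    | succ t ih =>
      rw [growth_succ, tower_m_succ_succ]
      rw [growth_succ, zero_add] at ih
      have h1 := half_m_le_tower_D 0 t
      have h2 := two_pow_le_tower_l 0 t
      have h3 : 2 ^ (Ack 2 t + 6) ≤ 2 ^ ((tower 0).D t - 4) :=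
        Nat.pow_le_pow_right (by norm_num) (by omega)
      rw [Ack_add_two_succ 0 t]
      have h4 : Ack (0 + 1) (Ack (0 + 2) t) = 2 ^ (Ack 2 t) := rfl
      have h5 : 1 ≤ 2 ^ (Ack 2 t) := Nat.one_le_two_pow
      rw [pow_add] at h3
      simp only [growth, id]
      omega
  | succ r ihr =>
    induction t with
    | zero => simp [Ack, growth, levels]
    | succ t ih =>
      rw [growth_succ, tower_m_succ_succ]
      rw [growth_succ] at ih
      have h1 := half_m_le_tower_D (r + 1) t
      have h2 := two_pow_le_tower_l (r + 1) t
      have h3 : 2 ^ (Ack (r + 1 + 2) t) ≤ 2 ^ ((tower (r + 1)).D t - 4) :=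
        Nat.pow_le_pow_right (by norm_num) (by omega)
      have h4 : Ack (r + 1 + 2) t < 2 ^ (Ack (r + 1 + 2) t) := Nat.lt_two_pow_self
      rw [Ack_add_two_succ (r + 1) t]
      refine le_trans ?_ (ihr _)
      have : Ack (r + 1 + 1) (Ack (r + 1 + 2) t) ≤ Ack (r + 2) ((tower (r + 1)).l (t + 1)) :=
        Ack_mono (r + 1) (by omega : Ack (r + 1 + 2) t ≤ (tower (r + 1)).l (t + 1))
      omega

theorem prod_collision_le (r : ℕ) {T₀ t Z : ℕ} (hT : T₀ ≤ t) (hZ : Z + 2 ≤ 2 ^ (T₀ + 5)) :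
    ∏ j ∈ Ico T₀ t, (1 + ((2 : ℝ) ^ (tower r).D j)⁻¹) ≤ 1 + ((2 : ℝ) ^ Z)⁻¹ := by
  suffices h : ∏ j ∈ Ico T₀ t, (1 + ((2 : ℝ) ^ (tower r).D j)⁻¹) ≤
      1 + ((2 : ℝ) ^ Z)⁻¹ * (1 - ((2 : ℝ) ^ (t - T₀))⁻¹) by
    refine h.trans ?_
    have h1 : 0 < ((2 : ℝ) ^ Z)⁻¹ := by positivity
    have h2 : 0 < ((2 : ℝ) ^ (t - T₀))⁻¹ := by positivity
    nlinarith
  induction t, hT using Nat.le_induction with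
  | base => simp
  | succ t hT ih =>
    rw [prod_Ico_succ_top hT]
    set y := ((2 : ℝ) ^ Z)⁻¹ with hy
    set s := ((2 : ℝ) ^ (t - T₀))⁻¹ with hs
    have hy0 : 0 < y := by positivity
    have hs0 : 0 < s := by positivity
    have hy1 : y ≤ 1 := inv_le_one_of_one_le₀ (one_le_pow₀ (by norm_num))
    have hs1 : s ≤ 1 := inv_le_one_of_one_le₀ (one_le_pow₀ (by norm_num))
    have e1 : ((2 : ℝ) ^ (t + 1 - T₀))⁻¹ = s / 2 := by
      rw [hs, show t + 1 - T₀ = t - T₀ + 1 by omega, pow_succ, mul_inv]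
      ring
    have e2 : ((2 : ℝ) ^ (tower r).D t)⁻¹ ≤ y * s / 4 := by
      have : y * s / 4 = ((2 : ℝ) ^ (Z + (t - T₀) + 2))⁻¹ := by
        rw [hy, hs, pow_add, pow_add, mul_inv, mul_inv]
        norm_num
        ring
      rw [this]
      refine inv_anti₀ (by positivity) (pow_le_pow_right₀ (by norm_num) ?_)
      refine le_trans ?_ (two_pow_le_tower_D r t)
      have h1 : 2 ^ (T₀ + 5) ≤ 2 ^ (t + 5) := Nat.pow_le_pow_right (by norm_num) (by omega)
      have h2 : t + 5 < 2 ^ (t + 5) := Nat.lt_two_pow_self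
      have h3 : 2 ^ (t + 6) = 2 * 2 ^ (t + 5) := by rw [pow_succ, mul_comm]
      omega
    rw [e1]
    calc _ ≤ (1 + y * (1 - s)) * (1 + y * s / 4) := by
          gcongr
      _ ≤ 1 + y * (1 - s / 2) := by
          have : 0 ≤ y * s * (1 - y * (1 - s)) := by
            refine mul_nonneg (mul_pos hy0 hs0).le ?_
            nlinarith
          nlinarith [mul_pos hy0 hs0]

/-- The `n`-th bit of `w`; it is `false` beyond the length of `w`. -/
def bit {N : ℕ} (w : Fin N → Bool) (n : ℕ) : Bool := if h : n < N then w ⟨n, h⟩ else false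

theorem unifBits_bit (N : ℕ) : UnifBits (univ : Finset (Fin N → Bool)) bit N := by
  intro c
  have h : ({x : Fin N → Bool | ∀ i < N, bit x i = c i} : Finset (Fin N → Bool)) =
      {(fun i => c i : Fin N → Bool)} := by
    ext w
    simp only [mem_filter, mem_univ, true_and, mem_singleton]
    constructor
    · intro h
      funext i
      simpa [bit] using h i i.2
    · rintro rfl i hi
      simp [bit, hi]
  rw [h, card_singleton, one_mul, card_univ, Fintype.card_fun, Fintype.card_bool, Fintype.card_fin]

/-- A bit sequence whose first `n` bits are uniform remains so after passing to the values of a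
function with fibres of equal size. -/
theorem UnifBits.of_image {Ω E : Type*} [Fintype Ω] [DecidableEq E] {f : Ω → E}
    {b : E → ℕ → Bool} {n M : ℕ} (hM : ∀ ω, #{ω' | f ω' = f ω} = M)
    (h : UnifBits (univ : Finset Ω) (fun ω => b (f ω)) n) : UnifBits (univ.image f) b n := by
  intro c
  rcases isEmpty_or_nonempty Ω with hΩ | ⟨⟨ω₀⟩⟩
  · simp
  have hM0 : 0 < M := by
    rw [← hM ω₀]
    exact card_pos.2 ⟨ω₀, by simp⟩
  have cnt (p : E → Prop) [DecidablePred p] :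
      #{ω | p (f ω)} = #{e ∈ univ.image f | p e} * M := by
    rw [card_eq_sum_card_fiberwise (f := f) (t := {e ∈ univ.image f | p e})
      (fun ω hω => by
        simp only [coe_filter, mem_univ, true_and, Set.mem_ofPred_eq] at hω
        simp [hω]), sum_const_nat]
    intro e he
    obtain ⟨he, hpe⟩ := mem_filter.1 he
    obtain ⟨ω, _, rfl⟩ := mem_image.1 he
    rw [← hM ω, filter_filter]
    congr 1
    ext ω'
    simp only [mem_filter, mem_univ, true_and, and_iff_right_iff_imp]
    intro h
    rwa [h]
  have h1 := h c
  rw [cnt fun e => ∀ i < n, b e i = c i] at h1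
  have h2 := cnt fun _ => True
  simp only [filter_true] at h2
  rw [h2] at h1
  refine Nat.eq_of_mul_eq_mul_right hM0 ?_
  rw [← h1]
  ring

section Coloring

variable {ι : Type*} {N : ℕ}

/-- The bit sequence attached to a tuple of vertices, one for each class in the list. -/
noncomputable def color : ℕ → List ι → (ι → Fin N → Bool) → ℕ → Bool
  | 0, p :: _, ω => bit (ω p)
  | r + 1, p :: q :: L, ω => fun j =>
    if bit (ω p) 0 = bit (ω q) 0 then (tower r).val j (color r (q :: L) ω) (bit (ω p))
    else (tower r).val j (color r (p :: L) ω) (bit (ω q))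
  | _, _, _ => fun _ => false

theorem color_congr (r : ℕ) {L : List ι} {ω ω' : ι → Fin N → Bool} (h : ∀ i ∈ L, ω i = ω' i) :
    color r L ω = color r L ω' := by
  induction r generalizing L with
  | zero =>
    cases L with
    | nil => rfl
    | cons p L => simp only [color, h p (by simp)]
  | succ r ih =>
    rcases L with _ | ⟨p, _ | ⟨q, L⟩⟩
    · rfl
    · rfl
    · funext j
      simp only [color]
      rw [h p (by simp), h q (by simp), ih fun i hi => h i (List.mem_cons_of_mem _ hi),
        ih (L := p :: L) fun i hi => h i (by
          rcases List.mem_cons.1 hi with rfl | hi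
          · simp
          · simp [hi])]

theorem forall_color_iff_of_eq {r : ℕ} {p q : ι} {L : List ι} {ω : ι → Fin N → Bool} {t : ℕ}
    {c : ℕ → Bool} (h : bit (ω p) 0 = bit (ω q) 0) :
    (∀ j < t, color (r + 1) (p :: q :: L) ω j = c j) ↔
      (tower r).Adj c 0 t (color r (q :: L) ω) (bit (ω p)) := by
  simp only [color, h, if_true, CodeTower.Adj, mem_Ico, zero_le, true_and]

theorem forall_color_iff_of_ne {r : ℕ} {p q : ι} {L : List ι} {ω : ι → Fin N → Bool} {t : ℕ}
    {c : ℕ → Bool} (h : bit (ω p) 0 ≠ bit (ω q) 0) :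
    (∀ j < t, color (r + 1) (p :: q :: L) ω j = c j) ↔
      (tower r).Adj c 0 t (color r (p :: L) ω) (bit (ω q)) := by
  simp only [color, h, if_false, CodeTower.Adj, mem_Ico, zero_le, true_and]

variable [Fintype ι] [DecidableEq ι]

theorem sum_update (p : ι) (F : (ι → Fin N → Bool) → ℝ) :
    ∑ ω, ∑ w, F (Function.update ω p w) = (2 : ℝ) ^ N * ∑ ω, F ω := by
  have h : ∑ z : (ι → Fin N → Bool) × (Fin N → Bool), F (Function.update z.1 p z.2) =
      ∑ z : (ι → Fin N → Bool) × (Fin N → Bool), F z.1 :=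
    sum_bij' (fun z _ => (Function.update z.1 p z.2, z.1 p))
      (fun z _ => (Function.update z.1 p z.2, z.1 p)) (by simp) (by simp) (by simp) (by simp)
      (by simp)
  rw [← Fintype.sum_prod_type', h, Fintype.sum_prod_type, mul_sum]
  refine sum_congr rfl fun ω _ => ?_
  simp

/-- The number of bits per vertex that determine the first `t` bits of a color. -/
noncomputable def bitsUsed : ℕ → ℕ → ℕ
  | 0 => id
  | r + 1 => (tower r).m

theorem bitsUsed_le_bitsNeeded (r t : ℕ) : bitsUsed r t ≤ bitsNeeded r t := by
  cases r with
  | zero => exact le_rfl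
  | succ r => exact ((tower r).m_mono (Nat.le_succ t)).trans (le_max_left _ _)

theorem card_adj_bit {r t : ℕ} (ht : (tower r).m t ≤ N) (c s : ℕ → Bool) (δ : Bool) :
    (∑ w : Fin N → Bool, if bit w 0 = δ ∧ (tower r).Adj c 0 t s (bit w) then 1 else 0 : ℝ) =
      2 ^ N / 2 / 2 ^ t := by
  have h0 := (tower r).card_adj (unifBits_bit N) ht (Nat.zero_le t) c s (fun w => bit w 0 = δ)
    (fun x _ y _ h => by rw [h 0 (by rw [(tower r).m_zero]; exact one_pos)])
  have h1 := ((unifBits_bit N).mono (((tower r).one_le_m t).trans ht)).card_eq fun _ => δ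
  rw [sum_boole, h0]
  simp only [Nat.lt_one_iff, forall_eq, pow_one] at h1
  rw [h1, card_univ, Fintype.card_fun, Fintype.card_bool, Fintype.card_fin]
  simp

theorem unifBits_color {r t : ℕ} {L : List ι} (hL : L.Nodup) (hr : L.length = r + 1)
    (ht : bitsUsed r t ≤ N) :
    UnifBits (univ : Finset (ι → Fin N → Bool)) (color r L) t := by
  intro c
  rw [← Nat.cast_inj (R := ℝ)]
  push_cast
  rw [← sum_boole]
  have hN : (2 : ℝ) ^ N ≠ 0 := by positivity
  refine mul_left_cancel₀ hN ?_
  rw [← mul_assoc]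
  rcases r with _ | r
  · rcases L with _ | ⟨p, L⟩
    · simp at hr
    rw [← sum_update p]
    simp only [color, Function.update_self]
    have h1 := ((unifBits_bit N).mono (show t ≤ N from ht)).card_eq c
    simp only [sum_boole, h1]
    rw [sum_const, card_univ (α := Fin N → Bool), nsmul_eq_mul, Fintype.card_fun,
      Fintype.card_bool, Fintype.card_fin]
    push_cast
    field_simp
  · rcases L with _ | ⟨p, _ | ⟨q, L⟩⟩
    · simp at hr
    · simp at hr
    have hpq : p ≠ q := by rintro rfl; simp at hL
    have hpL : p ∉ q :: L := (List.nodup_cons.1 hL).1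
    have hqL : q ∉ p :: L := by
      have := (List.nodup_cons.1 (List.nodup_cons.1 hL).2).1
      simp [this, hpq.symm]
    have split (ω : ι → Fin N → Bool) :
        (if ∀ i < t, color (r + 1) (p :: q :: L) ω i = c i then 1 else 0 : ℝ) =
          (if bit (ω p) 0 = bit (ω q) 0 ∧
            (tower r).Adj c 0 t (color r (q :: L) ω) (bit (ω p)) then 1 else 0) +
          (if bit (ω q) 0 = !bit (ω p) 0 ∧
            (tower r).Adj c 0 t (color r (p :: L) ω) (bit (ω q)) then 1 else 0) := by
      by_cases h : bit (ω p) 0 = bit (ω q) 0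
      · have h' : ¬ (bit (ω q) 0 = !bit (ω p) 0) := by rw [h]; simp
        simp [forall_color_iff_of_eq h, h]
      · have h' : bit (ω q) 0 = !bit (ω p) 0 := by
          revert h; cases bit (ω p) 0 <;> cases bit (ω q) 0 <;> simp
        rw [if_neg (fun h1 => h h1.1 : ¬ (bit (ω p) 0 = bit (ω q) 0 ∧ _)), zero_add]
        simp only [forall_color_iff_of_ne h, h', true_and]
    simp only [split]
    rw [sum_add_distrib, mul_add, ← sum_update p, ← sum_update q]
    have e1 (ω : ι → Fin N → Bool) (w : Fin N → Bool) :
        color r (q :: L) (Function.update ω p w) = color r (q :: L) ω :=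
      color_congr r fun i hi => Function.update_of_ne (by rintro rfl; exact hpL hi) _ _
    have e2 (ω : ι → Fin N → Bool) (w : Fin N → Bool) :
        color r (p :: L) (Function.update ω q w) = color r (p :: L) ω :=
      color_congr r fun i hi => Function.update_of_ne (by rintro rfl; exact hqL hi) _ _
    simp only [e1, e2, Function.update_self, Function.update_of_ne hpq.symm,
      Function.update_of_ne hpq, card_adj_bit (show (tower r).m t ≤ N from ht)]
    rw [sum_const, nsmul_eq_mul]
    field_simp
    ring

end Coloring

section Edges

theorem mem_transversals {κ V : Type*} [DecidableEq κ] [DecidableEq V] {I : Finset κ}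
    {Z : κ → Finset V} {e : Finset V} :
    e ∈ transversals I Z ↔ e ⊆ I.biUnion Z ∧ ∀ i ∈ I, #(e ∩ Z i) = 1 := by
  simp only [transversals, mem_filter, mem_powerset]

variable {ι : Type*} [DecidableEq ι] {N : ℕ}

/-- The set of vertices `(i, ω i)` with `i ∈ S`. -/
def tupleSet (S : Finset ι) (ω : ι → Fin N → Bool) : Finset (ι × (Fin N → Bool)) :=
  S.image fun i => (i, ω i)

open Classical in
/-- The entry of `e` in the class with index `i`. -/
noncomputable def coord (e : Finset (ι × (Fin N → Bool))) (i : ι) : Fin N → Bool :=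
  if h : ∃ w, (i, w) ∈ e then h.choose else fun _ => false

theorem mem_tupleSet {S : Finset ι} {ω : ι → Fin N → Bool} {v : ι × (Fin N → Bool)} :
    v ∈ tupleSet S ω ↔ v.1 ∈ S ∧ v.2 = ω v.1 := by
  rcases v with ⟨i, w⟩
  simp only [tupleSet, mem_image, Prod.mk.injEq]
  constructor
  · rintro ⟨_, h, rfl, rfl⟩; exact ⟨h, rfl⟩
  · rintro ⟨h, rfl⟩; exact ⟨i, h, rfl, rfl⟩

theorem coord_tupleSet {S : Finset ι} {ω : ι → Fin N → Bool} {i : ι} (hi : i ∈ S) :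
    coord (tupleSet S ω) i = ω i := by
  have h : ∃ w, (i, w) ∈ tupleSet S ω := ⟨ω i, mem_tupleSet.2 ⟨hi, rfl⟩⟩
  rw [coord, dif_pos h]
  exact (mem_tupleSet.1 h.choose_spec).2

theorem tupleSet_congr {S : Finset ι} {ω ω' : ι → Fin N → Bool} (h : ∀ i ∈ S, ω i = ω' i) :
    tupleSet S ω = tupleSet S ω' :=
  image_congr fun i hi => by simp only [h i hi]

theorem tupleSet_eq_iff {S : Finset ι} {ω ω' : ι → Fin N → Bool} :
    tupleSet S ω = tupleSet S ω' ↔ ∀ i ∈ S, ω i = ω' i :=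
  ⟨fun h i hi => by rw [← coord_tupleSet (ω := ω) hi, h, coord_tupleSet hi], tupleSet_congr⟩

variable [Fintype ι]

/-- The vertex class with index `i`. -/
def vclass (N : ℕ) (i : ι) : Finset (ι × (Fin N → Bool)) := univ.filter fun v => v.1 = i

@[simp] theorem mem_vclass {i : ι} {v : ι × (Fin N → Bool)} : v ∈ vclass N i ↔ v.1 = i := by
  simp [vclass]

theorem mem_transversals_iff {S : Finset ι} {e : Finset (ι × (Fin N → Bool))} :
    e ∈ transversals S (vclass N) ↔ e = tupleSet S (coord e) := by
  rw [mem_transversals]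
  constructor
  · rintro ⟨h1, h2⟩
    have hc : ∀ i ∈ S, ∀ w, (i, w) ∈ e → w = coord e i := by
      intro i hi w hw
      obtain ⟨v, hv⟩ := card_eq_one.1 (h2 i hi)
      have hex : ∃ w, (i, w) ∈ e := ⟨w, hw⟩
      have hm1 : (i, w) ∈ e ∩ vclass N i := by simp [hw]
      have hm2 : (i, coord e i) ∈ e ∩ vclass N i := by
        rw [coord, dif_pos hex]
        simpa using hex.choose_spec
      rw [hv, mem_singleton] at hm1 hm2
      exact (Prod.mk.inj (hm1.trans hm2.symm)).2
    ext ⟨i, w⟩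
    rw [mem_tupleSet]
    constructor
    · intro hv
      obtain ⟨j, hj, hvj⟩ := mem_biUnion.1 (h1 hv)
      rw [mem_vclass] at hvj
      subst hvj
      exact ⟨hj, hc _ hj w hv⟩
    · rintro ⟨hi, hw⟩
      obtain ⟨⟨j, w'⟩, hv⟩ := card_eq_one.1 (h2 i hi)
      have hm : (j, w') ∈ e ∩ vclass N i := by rw [hv]; simp
      rw [mem_inter, mem_vclass] at hm
      obtain ⟨hm, rfl⟩ := hm
      rw [show w = w' from hw.trans (hc _ hi w' hm).symm]
      exact hm
  · intro he
    rw [he]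
    constructor
    · intro v hv
      exact mem_biUnion.2 ⟨v.1, (mem_tupleSet.1 hv).1, by simp⟩
    · intro i hi
      rw [card_eq_one]
      refine ⟨(i, coord e i), ?_⟩
      ext ⟨j, w⟩
      simp only [mem_inter, mem_tupleSet, mem_vclass, mem_singleton, Prod.mk.injEq]
      constructor
      · rintro ⟨⟨_, rfl⟩, rfl⟩; exact ⟨rfl, rfl⟩
      · rintro ⟨rfl, rfl⟩; exact ⟨⟨hi, rfl⟩, rfl⟩

theorem tupleSet_mem_transversals (S : Finset ι) (ω : ι → Fin N → Bool) :
    tupleSet S ω ∈ transversals S (vclass N) :=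
  mem_transversals_iff.2 (tupleSet_congr fun _ hi => (coord_tupleSet hi).symm)

theorem transversals_eq_image (S : Finset ι) :
    transversals S (vclass N) = univ.image (tupleSet S) := by
  ext e
  rw [mem_image]
  constructor
  · exact fun h => ⟨coord e, mem_univ _, (mem_transversals_iff.1 h).symm⟩
  · rintro ⟨ω, _, rfl⟩; exact tupleSet_mem_transversals S ω

theorem card_of_mem_transversals {S : Finset ι} {e : Finset (ι × (Fin N → Bool))}
    (he : e ∈ transversals S (vclass N)) : #e = #S := by
  rw [mem_transversals_iff.1 he, tupleSet, card_image_of_injective]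
  exact fun i j h => (Prod.mk.inj h).1

theorem unifBits_transversals {r t : ℕ} {L : List ι} (hL : L.Nodup) (hr : L.length = r + 1)
    (ht : bitsUsed r t ≤ N) :
    UnifBits (transversals L.toFinset (vclass N)) (fun e => color r L (coord e)) t := by
  rw [transversals_eq_image]
  refine UnifBits.of_image (M := #{ω' | tupleSet L.toFinset ω' =
    tupleSet L.toFinset (fun _ _ => false : ι → Fin N → Bool)}) (fun ω => ?_) ?_
  · simp only [tupleSet_eq_iff]
    refine card_bij' (fun ω' _ => L.toFinset.piecewise (fun _ _ => false) ω')
      (fun ω' _ => L.toFinset.piecewise ω ω') ?_ ?_ ?_ ?_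
    · intro ω' _
      simp +contextual [piecewise]
    · intro ω' _
      simp +contextual [piecewise]
    · intro ω' h
      simp only [mem_filter, mem_univ, true_and] at h
      funext i
      by_cases hi : i ∈ L.toFinset
      · simp [piecewise, hi, h i hi]
      · simp [piecewise, hi]
    · intro ω' h
      simp only [mem_filter, mem_univ, true_and] at h
      funext i
      by_cases hi : i ∈ L.toFinset
      · simp [piecewise, hi, h i hi]
      · simp [piecewise, hi]
  · have := unifBits_color (ι := ι) hL hr ht
    have e : (fun ω => color r L (coord (tupleSet L.toFinset ω))) = color r L (N := N) := by
      funext ω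
      exact color_congr r fun i hi => coord_tupleSet (List.mem_toFinset.2 hi)
    rw [e]
    exact this

theorem unifBits_vclass (i : ι) : UnifBits (vclass N i) (fun v => bit v.2) N := by
  intro c
  have key (s : (Fin N → Bool) → Prop) [DecidablePred s] :
      #{v ∈ vclass N i | s v.2} = #{w | s w} := by
    refine card_bij' (fun v _ => v.2) (fun w _ => (i, w)) (by simp) (by simp) ?_ (by simp)
    rintro ⟨j, w⟩ hv
    simp only [mem_filter, mem_vclass] at hv
    rw [← hv.1]
  have h := key fun _ => True
  simp only [filter_true] at h
  rw [key fun w => ∀ j < N, bit w j = c j, h]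
  exact unifBits_bit N c

/-- The hypergraph of the transversals whose first `t` bits agree with `c`. -/
noncomputable def codeEdges (N r : ℕ) (L : List ι) (t : ℕ) (c : ℕ → Bool) :
    Finset (Finset (ι × (Fin N → Bool))) :=
  {e ∈ transversals L.toFinset (vclass N) | ∀ j < t, color r L (coord e) j = c j}

theorem insert_eq_tupleSet {S : Finset ι} {i : ι} (hi : i ∉ S) {f : Finset (ι × (Fin N → Bool))}
    (hf : f ∈ transversals S (vclass N)) {v : ι × (Fin N → Bool)} (hv : v ∈ vclass N i) :
    insert v f = tupleSet (insert i S) (Function.update (coord f) i v.2) := by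
  rcases v with ⟨j, w⟩
  rw [mem_vclass] at hv
  subst hv
  simp only at hi ⊢
  ext ⟨j', w'⟩
  rw [mem_insert, mem_tupleSet, mem_insert]
  nth_rw 1 [mem_transversals_iff.1 hf]
  rw [mem_tupleSet]
  simp only [Prod.mk.injEq]
  by_cases hj : j' = j
  · subst hj
    simp [hi]
  · simp [hj]

theorem insert_tupleSet_erase {S : Finset ι} {i : ι} (hi : i ∈ S)
    {e : Finset (ι × (Fin N → Bool))} (he : e ∈ transversals S (vclass N)) :
    insert (i, coord e i) (tupleSet (S.erase i) (coord e)) = e := by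
  conv_rhs => rw [mem_transversals_iff.1 he, ← insert_erase hi, tupleSet, image_insert]
  rfl

theorem card_auxGraph {S : Finset ι} {i : ι} (hi : i ∈ S)
    {E : Finset (Finset (ι × (Fin N → Bool)))} (hE : E ⊆ transversals S (vclass N)) :
    #(auxGraph E (transversals (S.erase i) (vclass N)) (vclass N i)) = #E := by
  refine card_nbij' (fun z => insert z.2 z.1)
    (fun e => (tupleSet (S.erase i) (coord e), (i, coord e i))) ?_ ?_ ?_ ?_
  · intro z hz
    exact (mem_filter.1 hz).2
  · intro e he
    rw [mem_coe, auxGraph, mem_filter, mem_product]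
    refine ⟨⟨tupleSet_mem_transversals _ _, by simp⟩, ?_⟩
    rw [insert_tupleSet_erase hi (hE he)]
    exact he
  · rintro ⟨f, v⟩ hz
    rw [mem_coe, auxGraph, mem_filter, mem_product] at hz
    obtain ⟨⟨hf, hv⟩, -⟩ := hz
    have h := insert_eq_tupleSet (notMem_erase i S) hf hv
    simp only at h ⊢
    rw [insert_erase hi] at h
    have hc (j : ι) (hj : j ∈ S) : coord (insert v f) j = Function.update (coord f) i v.2 j := by
      rw [h, coord_tupleSet hj]
    refine Prod.ext ?_ (Prod.ext (mem_vclass.1 hv).symm ?_)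
    · refine (tupleSet_congr fun j hj => ?_).trans (mem_transversals_iff.1 hf).symm
      rw [hc j (mem_of_mem_erase hj), Function.update_of_ne (ne_of_mem_erase hj)]
    · simp only
      rw [hc i hi, Function.update_self]
  · intro e he
    exact insert_tupleSet_erase hi (hE he)

theorem card_transversals {S : Finset ι} {i : ι} (hi : i ∈ S) :
    #(transversals S (vclass N)) =
      #(transversals (S.erase i) (vclass N)) * #(vclass N i) := by
  rw [← card_auxGraph hi Subset.rfl, auxGraph, filter_true_of_mem, card_product]
  rintro ⟨f, v⟩ hz
  obtain ⟨hf, hv⟩ := mem_product.1 hz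
  rw [insert_eq_tupleSet (notMem_erase i S) hf hv, insert_erase hi]
  exact tupleSet_mem_transversals _ _

end Edges

section Averaging

variable {α : Type*} [DecidableEq α]

/-- Some class of the partition by the first `n` bits is almost a union of parts of an approximate
refinement. -/
theorem ApproxRefines.exists_union {X : Finset α} {PX : Finset (Finset α)} {a : α → ℕ → Bool}
    {n : ℕ} {γ : ℝ} (h : ApproxRefines γ X PX a n) (hγ : 0 ≤ γ) (hX : UnifBits X a n)
    (hsub : ∀ q ∈ PX, q ⊆ X) (hdisj : (PX : Set (Finset α)).PairwiseDisjoint id)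
    (hcover : ∀ v ∈ X, ∃ q ∈ PX, v ∈ q) :
    ∃ (c : ℕ → Bool), ∃ U ⊆ PX,
      (#(symmDiff {x ∈ X | ∀ i < n, a x i = c i} (U.biUnion id)) : ℝ) ≤
        4 * γ * #{x ∈ X | ∀ i < n, a x i = c i} := by
  classical
  obtain ⟨B, cell, hBX, hBcard, hB⟩ := h.exists_misplaced hγ hsub hdisj hcover
  set ext : (Fin n → Bool) → ℕ → Bool := fun u i => if hi : i < n then u ⟨i, hi⟩ else false with hext
  have hextc (u : Fin n → Bool) (s : ℕ → Bool) : (∀ i < n, s i = ext u i) ↔ u = blk 0 n s := by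
    constructor
    · intro hs
      funext i
      have := hs i i.2
      simp only [hext, i.2, dif_pos] at this
      simp [blk, this]
    · rintro rfl i hi
      simp [hext, hi, blk]
  set Gc : (Fin n → Bool) → Finset α := fun u => {x ∈ X | ∀ i < n, a x i = ext u i} with hGc
  set Uc : (Fin n → Bool) → Finset (Finset α) := fun u =>
    {q ∈ PX | ∀ i < n, cell q i = ext u i} with hUc
  choose! part hpart using hcover
  have hmem (u : Fin n → Bool) (x : α) : x ∈ (Uc u).biUnion id ↔
      x ∈ X ∧ ∀ i < n, cell (part x) i = ext u i := by
    simp only [mem_biUnion, id, hUc, mem_filter]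
    constructor
    · rintro ⟨q, ⟨hq, hqc⟩, hx⟩
      have hxX := hsub q hq hx
      have : q = part x := hdisj.elim hq (hpart x hxX).1
        (not_disjoint_iff.2 ⟨x, hx, (hpart x hxX).2⟩)
      exact ⟨hxX, this ▸ hqc⟩
    · rintro ⟨hx, hc⟩
      exact ⟨part x, ⟨(hpart x hx).1, hc⟩, (hpart x hx).2⟩
  have hdiff (u : Fin n → Bool) : symmDiff (Gc u) ((Uc u).biUnion id) ⊆
      {x ∈ B | u = blk 0 n (a x) ∨ u = blk 0 n (cell (part x))} := by
    intro x hx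
    rw [mem_symmDiff, hmem, hGc, mem_filter, hextc, hextc] at hx
    rw [mem_filter]
    refine ⟨?_, by tauto⟩
    by_contra hxB
    have hxX : x ∈ X := by tauto
    obtain ⟨q, hq, hxq, hcell, -⟩ := hB x hxX hxB
    have : q = part x := hdisj.elim hq (hpart x hxX).1
      (not_disjoint_iff.2 ⟨x, hxq, (hpart x hxX).2⟩)
    subst this
    have : blk 0 n (a x) = blk 0 n (cell (part x)) :=
      blk_eq_iff.2 fun i _ hi => hcell i (by omega)
    rw [this] at hx
    tauto
  have hsum : ∑ u, (#(symmDiff (Gc u) ((Uc u).biUnion id)) : ℝ) ≤ ∑ _u : Fin n → Bool,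
      4 * γ * (#X / 2 ^ n) := by
    calc ∑ u, (#(symmDiff (Gc u) ((Uc u).biUnion id)) : ℝ)
        ≤ ∑ u, (#{x ∈ B | u = blk 0 n (a x) ∨ u = blk 0 n (cell (part x))} : ℝ) :=
          sum_le_sum fun u _ => by exact_mod_cast card_le_card (hdiff u)
      _ = ∑ x ∈ B, (#{u | u = blk 0 n (a x) ∨ u = blk 0 n (cell (part x))} : ℝ) := by
          simp only [← sum_boole]
          exact sum_comm
      _ ≤ ∑ x ∈ B, 2 := by
          refine sum_le_sum fun x _ => ?_
          rw [filter_or, filter_eq', filter_eq']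
          simp only [mem_univ, if_true]
          exact_mod_cast card_union_le _ _
      _ = 2 * #B := by rw [sum_const, nsmul_eq_mul, mul_comm]
      _ ≤ 2 * (2 * γ * #X) := by gcongr
      _ = _ := by
          rw [sum_const, card_univ, Fintype.card_fun, Fintype.card_bool, Fintype.card_fin,
            nsmul_eq_mul]
          push_cast
          field_simp
          ring
  obtain ⟨u, -, hu⟩ := exists_le_of_sum_le univ_nonempty hsum
  refine ⟨ext u, Uc u, filter_subset _ _, ?_⟩
  rw [hX.card_eq (ext u)]
  exact hu

end Averaging

section Union

variable {α β : Type*} [DecidableEq α] [DecidableEq β]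

theorem BipRegular.mono {δ δ' : ℝ} {G : Finset (α × β)} {A : Finset α} {B : Finset β}
    (h : BipRegular δ G A B) (hδ : δ ≤ δ') : BipRegular δ' G A B := by
  intro A' hA' B' hB' h1 h2
  exact h A' hA' B' hB' ((by gcongr : δ * (#A : ℝ) ≤ δ' * #A).trans h1)
    ((by gcongr : δ * (#B : ℝ) ≤ δ' * #B).trans h2)

theorem bipRegular_of_inter_eq_empty {δ : ℝ} {G : Finset (α × β)} {A : Finset α} {B : Finset β}
    (h : G ∩ A ×ˢ B = ∅) : BipRegular δ G A B := by
  intro A' _ B' _ _ _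
  simp only [bipDensity, h]
  rw [card_empty, Nat.cast_zero, zero_div, mul_zero]
  positivity

/-- The union of edge-disjoint regular bipartite graphs is regular. -/
theorem bipRegular_biUnion {κ : Type*} {δ : ℝ} {U : Finset κ} {G : κ → Finset (α × β)}
    {A : Finset α} {B : Finset β} (hdisj : (U : Set κ).PairwiseDisjoint G)
    (h : ∀ x ∈ U, BipRegular δ (G x) A B) : BipRegular δ (U.biUnion G) A B := by
  have hd (A' : Finset α) (B' : Finset β) :
      bipDensity (U.biUnion G) A' B' = ∑ x ∈ U, bipDensity (G x) A' B' := by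
    simp only [bipDensity]
    rw [← sum_div, biUnion_inter, card_biUnion, Nat.cast_sum]
    intro x hx y hy hxy
    exact (hdisj hx hy hxy).mono inter_subset_left inter_subset_left
  intro A' hA' B' hB' h1 h2
  rw [hd, hd, mul_sum]
  exact sum_le_sum fun x hx => h x hx A' hA' B' hB' h1 h2

end Union

namespace KPartition

variable {ι : Type*} [Fintype ι] [DecidableEq ι] {N n : ℕ}
  (P : KPartition (ι × (Fin N → Bool)) n)

/-- The parts of level `r` on the vertex classes with index in `S`. -/
def edgeFamily (r : ℕ) (S : Finset ι) : Finset (Finset (Finset (ι × (Fin N → Bool)))) :=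
  (P.part r).parts.filter fun E => E ⊆ transversals S (vclass N)

/-- The clusters in the vertex class with index `i`. -/
def vertexFamily (i : ι) : Finset (Finset (ι × (Fin N → Bool))) :=
  P.vertexPart.parts.filter fun W => W ⊆ vclass N i

variable {P}

theorem edgeFamily_disjoint (r : ℕ) (S : Finset ι) :
    (P.edgeFamily r S : Set (Finset (Finset (ι × (Fin N → Bool))))).PairwiseDisjoint id :=
  (P.part r).disjoint.subset (by exact_mod_cast filter_subset _ _)

theorem vertexFamily_disjoint (i : ι) :
    (P.vertexFamily i : Set (Finset (ι × (Fin N → Bool)))).PairwiseDisjoint id :=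
  P.vertexPart.disjoint.subset (by exact_mod_cast filter_subset _ _)

theorem cluster_eq {W W' : Finset (ι × (Fin N → Bool))} (hW : W ∈ P.vertexPart.parts)
    (hW' : W' ∈ P.vertexPart.parts) {v : ι × (Fin N → Bool)} (h : v ∈ W) (h' : v ∈ W') : W = W' :=
  P.vertexPart.disjoint.elim hW hW' (not_disjoint_iff.2 ⟨v, h, h'⟩)

/-- The vertices of the edges in a part of level `r` are spread over `r` clusters. -/
theorem exists_clusters {r : ℕ} (hr : 1 ≤ r) (hrn : r ≤ n)
    {E : Finset (Finset (ι × (Fin N → Bool)))} (hE : E ∈ (P.part r).parts) :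
    ∃ Z : Fin r → Finset (ι × (Fin N → Bool)), Function.Injective Z ∧
      (∀ i, Z i ∈ P.vertexPart.parts) ∧ E ⊆ transversals univ Z := by
  rcases hr.eq_or_lt with rfl | hr
  · rw [P.part_one, mem_image] at hE
    obtain ⟨W, hW, rfl⟩ := hE
    refine ⟨fun _ => W, Function.injective_of_subsingleton _, fun _ => hW, fun e he => ?_⟩
    rw [mem_powersetCard] at he
    rw [mem_transversals]
    refine ⟨fun v hv => mem_biUnion.2 ⟨0, mem_univ _, he.1 hv⟩, fun i _ => ?_⟩
    rw [inter_eq_left.2 he.1, he.2]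
  · obtain ⟨Z, F, hZ, hEF⟩ := P.part_refines r hr hrn E hE
    exact ⟨Z, hZ.1, hZ.2.1, hEF.trans (filter_subset _ _)⟩

/-- Every cluster lies in a vertex class. -/
def Refines (P : KPartition (ι × (Fin N → Bool)) n) : Prop :=
  ∀ W ∈ P.vertexPart.parts, ∃ i, W ⊆ vclass N i

variable (hP : P.Refines)

include hP

theorem exists_vertexFamily {i : ι} : ∀ v ∈ vclass N i, ∃ W ∈ P.vertexFamily i, v ∈ W := by
  intro v hv
  obtain ⟨W, hW, hvW⟩ := P.vertexPart.exists_mem (mem_univ v)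
  obtain ⟨j, hj⟩ := hP W hW
  have h1 := mem_vclass.1 (hj hvW)
  rw [mem_vclass] at hv
  rw [← h1, hv] at hj
  exact ⟨W, mem_filter.2 ⟨hW, hj⟩, hvW⟩

theorem exists_index {r : ℕ} {S : Finset ι} (hS : #S = r)
    {Z : Fin r → Finset (ι × (Fin N → Bool))} (hZ : Function.Injective Z)
    (hZP : ∀ i, Z i ∈ P.vertexPart.parts) {e : Finset (ι × (Fin N → Bool))}
    (he : e ∈ transversals univ Z) (heS : e ∈ transversals S (vclass N)) :
    ∃ s : Fin r → ι, (∀ i, Z i ⊆ vclass N (s i)) ∧ Function.Injective s ∧ univ.image s = S := by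
  choose s hs using fun i => hP (Z i) (hZP i)
  have hv : ∀ i, ∃ v, v ∈ e ∧ v ∈ Z i := by
    intro i
    obtain ⟨v, hv⟩ := card_eq_one.1 ((mem_transversals.1 he).2 i (mem_univ i))
    have : v ∈ e ∩ Z i := by rw [hv]; simp
    exact ⟨v, mem_inter.1 this⟩
  choose v hve hvZ using hv
  have hvs (i) : (v i).1 = s i := mem_vclass.1 (hs i (hvZ i))
  have hvm (i) : (v i).1 ∈ S ∧ (v i).2 = coord e (v i).1 := by
    have := hve i
    rw [mem_transversals_iff.1 heS] at this
    have h2 := mem_tupleSet.1 this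
    exact h2
  have hinj : Function.Injective s := by
    intro i j hij
    have : v i = v j := by
      refine Prod.ext ?_ ?_
      · rw [hvs, hvs, hij]
      · rw [(hvm i).2, (hvm j).2, hvs, hvs, hij]
    exact hZ (cluster_eq (hZP i) (hZP j) (hvZ i) (this ▸ hvZ j))
  refine ⟨s, hs, hinj, eq_of_subset_of_card_le ?_ ?_⟩
  · intro h hh
    obtain ⟨i, -, rfl⟩ := mem_image.1 hh
    rw [← hvs]
    exact (hvm i).1
  · rw [card_image_of_injective _ hinj, card_univ, Fintype.card_fin, hS]

omit hP in
theorem mem_transversals_of_index {r : ℕ} {S : Finset ι}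
    {Z : Fin r → Finset (ι × (Fin N → Bool))} {s : Fin r → ι} (hs : ∀ i, Z i ⊆ vclass N (s i))
    (hinj : Function.Injective s) (hsS : univ.image s = S) {e : Finset (ι × (Fin N → Bool))}
    (he : e ∈ transversals univ Z) :
    e ∈ transversals S (vclass N) ∧ ∀ i, (s i, coord e (s i)) ∈ Z i := by
  have he' := he
  rw [mem_transversals] at he
  have hinter (i) : e ∩ vclass N (s i) = e ∩ Z i := by
    ext v
    rw [mem_inter, mem_inter]
    refine and_congr_right fun hv => ⟨fun hvi => ?_, fun hvi => hs i hvi⟩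
    obtain ⟨j, -, hj⟩ := mem_biUnion.1 (he.1 hv)
    have := mem_vclass.1 (hs j hj)
    rw [mem_vclass.1 hvi] at this
    rwa [hinj this]
  have heS : e ∈ transversals S (vclass N) := by
    rw [mem_transversals]
    constructor
    · intro v hv
      obtain ⟨j, -, hj⟩ := mem_biUnion.1 (he.1 hv)
      exact mem_biUnion.2 ⟨s j, hsS ▸ mem_image_of_mem s (mem_univ j), hs j hj⟩
    · intro h hh
      rw [← hsS] at hh
      obtain ⟨i, -, rfl⟩ := mem_image.1 hh
      rw [hinter]
      exact he.2 i (mem_univ i)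
  refine ⟨heS, fun i => ?_⟩
  have : (s i, coord e (s i)) ∈ e ∩ vclass N (s i) := by
    rw [mem_inter]
    refine ⟨?_, by simp⟩
    have hm : (s i, coord e (s i)) ∈ tupleSet S (coord e) :=
      mem_tupleSet.2 ⟨hsS ▸ mem_image_of_mem s (mem_univ i), rfl⟩
    rwa [← mem_transversals_iff.1 heS] at hm
  rw [hinter] at this
  exact (mem_inter.1 this).2

theorem exists_edgeFamily {r : ℕ} (hr : 1 ≤ r) (hrn : r ≤ n) {S : Finset ι} (hS : #S = r) :
    ∀ e ∈ transversals S (vclass N), ∃ E ∈ P.edgeFamily r S, e ∈ E := by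
  intro e he
  have hcross : e ∈ cross r P.vertexPart := by
    simp only [cross, mem_filter, mem_powersetCard_univ, card_of_mem_transversals he]
    refine ⟨hS, fun W hW => ?_⟩
    obtain ⟨i, hi⟩ := hP W hW
    rw [card_le_one]
    intro v hv v' hv'
    rw [mem_inter] at hv hv'
    have h1 := mem_vclass.1 (hi hv.2)
    have h2 := mem_vclass.1 (hi hv'.2)
    have h3 := hv.1
    have h4 := hv'.1
    rw [mem_transversals_iff.1 he, mem_tupleSet] at h3 h4
    exact Prod.ext (h1.trans h2.symm) (by rw [h3.2, h4.2, h1, h2])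
  obtain ⟨E, hE, heE⟩ := (P.part r).exists_mem hcross
  obtain ⟨Z, hZ, hZP, hEZ⟩ := exists_clusters hr hrn hE
  obtain ⟨s, hs, hinj, hsS⟩ := exists_index hP hS hZ hZP (hEZ heE) he
  exact ⟨E, mem_filter.2 ⟨hE, fun e' he' => (mem_transversals_of_index hs hinj hsS (hEZ he')).1⟩, heE⟩

theorem coord_mem_same_cluster {r : ℕ} (hr : 1 ≤ r) (hrn : r ≤ n) {S : Finset ι} (hS : #S = r)
    {E : Finset (Finset (ι × (Fin N → Bool)))} (hE : E ∈ P.edgeFamily r S)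
    {e e' : Finset (ι × (Fin N → Bool))} (he : e ∈ E) (he' : e' ∈ E) {i : ι} (hi : i ∈ S) :
    ∃ W ∈ P.vertexPart.parts, (i, coord e i) ∈ W ∧ (i, coord e' i) ∈ W := by
  obtain ⟨hEP, hES⟩ := mem_filter.1 hE
  obtain ⟨Z, hZ, hZP, hEZ⟩ := exists_clusters hr hrn hEP
  obtain ⟨s, hs, hinj, hsS⟩ := exists_index hP hS hZ hZP (hEZ he) (hES he)
  rw [← hsS] at hi
  obtain ⟨j, -, rfl⟩ := mem_image.1 hi
  exact ⟨Z j, hZP j, (mem_transversals_of_index hs hinj hsS (hEZ he)).2 j,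
    (mem_transversals_of_index hs hinj hsS (hEZ he')).2 j⟩

theorem bipRegular_auxGraph {δ : ℝ} (hgood : P.IsGood δ) {r : ℕ} (hr : 2 ≤ r) (hrn : r ≤ n)
    {S : Finset ι} (hS : #S = r) {E : Finset (Finset (ι × (Fin N → Bool)))}
    (hE : E ∈ P.edgeFamily r S) {h : ι} (hh : h ∈ S) {A : Finset (Finset (ι × (Fin N → Bool)))}
    (hA : A ∈ P.edgeFamily (r - 1) (S.erase h)) {B : Finset (ι × (Fin N → Bool))}
    (hB : B ∈ P.vertexFamily h) :
    BipRegular δ (auxGraph E (transversals (S.erase h) (vclass N)) (vclass N h)) A B := by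
  obtain ⟨hEP, hES⟩ := mem_filter.1 hE
  obtain ⟨hAP, hAS⟩ := mem_filter.1 hA
  obtain ⟨hBP, hBS⟩ := mem_filter.1 hB
  obtain ⟨Z, F, hZF, hEF⟩ := P.part_refines r hr hrn E hEP
  obtain ⟨hZ, hZP, hFP⟩ := id hZF
  have hEZ : E ⊆ transversals univ Z := hEF.trans (filter_subset _ _)
  obtain ⟨e₀, he₀⟩ := (P.part r).nonempty_of_mem_parts hEP
  obtain ⟨s, hs, hinj, hsS⟩ := exists_index hP hS hZ hZP (hEZ he₀) (hES he₀)
  have hh' := hh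
  rw [← hsS] at hh'
  obtain ⟨i, -, rfl⟩ := mem_image.1 hh'
  by_cases hcase : F i = A ∧ Z i = B
  · obtain ⟨rfl, rfl⟩ := hcase
    have key := hgood r hr hrn E hEP Z F hZF hEF i
    have hinter (A' : Finset (Finset (ι × (Fin N → Bool)))) (B' : Finset (ι × (Fin N → Bool)))
        (hA' : A' ⊆ F i) (hB' : B' ⊆ Z i) :
        bipDensity (auxGraph E (F i) (Z i)) A' B' =
          bipDensity (auxGraph E (transversals (S.erase (s i)) (vclass N)) (vclass N (s i)))
            A' B' := by
      unfold bipDensity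
      congr 3
      ext ⟨f, v⟩
      simp only [auxGraph, mem_inter, mem_filter, mem_product]
      constructor
      · rintro ⟨⟨-, hE'⟩, hf, hv⟩
        exact ⟨⟨⟨hAS (hA' hf), hBS (hB' hv)⟩, hE'⟩, hf, hv⟩
      · rintro ⟨⟨-, hE'⟩, hf, hv⟩
        exact ⟨⟨⟨hA' hf, hB' hv⟩, hE'⟩, hf, hv⟩
    intro A' hA' B' hB' h1 h2
    rw [← hinter _ _ Subset.rfl Subset.rfl, ← hinter _ _ hA' hB']
    exact key A' hA' B' hB' h1 h2
  · refine bipRegular_of_inter_eq_empty (eq_empty_iff_forall_notMem.2 ?_)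
    rintro ⟨f, v⟩ hfv
    simp only [auxGraph, mem_inter, mem_filter, mem_product] at hfv
    obtain ⟨⟨⟨hfS, hvS⟩, hfvE⟩, hfA, hvB⟩ := hfv
    have hcl := mem_filter.1 (hEF hfvE)
    have hcoord := (mem_transversals_of_index hs hinj hsS hcl.1).2 i
    rw [insert_eq_tupleSet (notMem_erase (s i) S) hfS hvS, insert_erase hh, coord_tupleSet hh,
      Function.update_self] at hcoord
    have hv : (s i, v.2) = v := by rw [← mem_vclass.1 hvS]
    rw [hv] at hcoord
    have hZB : Z i = B := cluster_eq (hZP i) hBP hcoord hvB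
    have hFf : insert v f \ Z i = f := by
      rw [insert_sdiff_of_mem _ hcoord, Finset.sdiff_eq_self_iff_disjoint, disjoint_left]
      intro u hu huZ
      have h1 := mem_vclass.1 (hs i huZ)
      rw [mem_transversals_iff.1 hfS, mem_tupleSet, h1] at hu
      exact notMem_erase _ _ hu.1
    have hfF := hcl.2 i
    rw [hFf] at hfF
    have hFA : F i = A := (P.part (r - 1)).disjoint.elim (hFP i).1 hAP
      (not_disjoint_iff.2 ⟨f, hfF, hfA⟩)
    exact hcase ⟨hFA, hZB⟩

/-- A good partition that approximately refines the hypergraphs `codeEdges` induces regular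
partitions of one of them. -/
theorem exists_bipRegularPartition {δ γ δ' : ℝ} (hgood : P.IsGood δ) (hγ : 0 ≤ γ) (hδ : δ ≤ δ')
    (hγδ : 4 * γ ≤ δ') {r : ℕ} (hrn : r + 2 ≤ n) {L : List ι} (hL : L.Nodup)
    (hLr : L.length = r + 2) {t : ℕ} (ht : bitsUsed (r + 1) t ≤ N)
    (href : ApproxRefines γ (transversals L.toFinset (vclass N)) (P.edgeFamily (r + 2) L.toFinset)
      (fun e => color (r + 1) L (coord e)) t) :
    ∃ c : ℕ → Bool, ∀ h ∈ L.toFinset,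
      BipRegularPartition δ' (transversals (L.toFinset.erase h) (vclass N)) (vclass N h)
        (auxGraph (codeEdges N (r + 1) L t c) (transversals (L.toFinset.erase h) (vclass N))
          (vclass N h)) (P.edgeFamily (r + 1) (L.toFinset.erase h)) (P.vertexFamily h) := by
  have hS : #L.toFinset = r + 2 := by rw [List.toFinset_card_of_nodup hL, hLr]
  obtain ⟨c, U, hU, hUc⟩ := href.exists_union hγ (unifBits_transversals hL hLr ht)
    (fun q hq => (mem_filter.1 hq).2) (edgeFamily_disjoint _ _)
    (exists_edgeFamily hP (by omega) hrn hS)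
  have hUS : U.biUnion id ⊆ transversals L.toFinset (vclass N) :=
    biUnion_subset.2 fun E hE => (mem_filter.1 (hU hE)).2
  refine ⟨c, fun h hh => ⟨auxGraph (U.biUnion id) (transversals (L.toFinset.erase h) (vclass N))
    (vclass N h), filter_subset _ _, ?_, ?_⟩⟩
  · have e1 (E E' : Finset (Finset (ι × (Fin N → Bool)))) (X Y) :
        symmDiff (auxGraph E X Y) (auxGraph E' X Y) = auxGraph (symmDiff E E') X Y := by
      ext z
      simp only [auxGraph, mem_symmDiff, mem_filter]
      tauto
    have hGS : codeEdges N (r + 1) L t c ⊆ transversals L.toFinset (vclass N) := filter_subset _ _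
    rw [e1, card_auxGraph hh (symmDiff_le_sup.trans (sup_le hGS hUS)), card_auxGraph hh hGS]
    exact hUc.trans (mul_le_mul_of_nonneg_right hγδ (Nat.cast_nonneg _))
  · intro A hA B hB
    have e2 : auxGraph (U.biUnion id) (transversals (L.toFinset.erase h) (vclass N)) (vclass N h) =
        U.biUnion fun E =>
          auxGraph E (transversals (L.toFinset.erase h) (vclass N)) (vclass N h) := by
      ext z
      simp only [auxGraph, mem_filter, mem_biUnion, id]
      constructor
      · rintro ⟨h1, E, hE, h2⟩; exact ⟨E, hE, h1, h2⟩
      · rintro ⟨E, hE, h1, h2⟩; exact ⟨h1, E, hE, h2⟩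
    rw [e2]
    refine (bipRegular_biUnion ?_ fun E hE =>
      bipRegular_auxGraph hP hgood (by omega) hrn hS (hU hE) hh hA hB).mono hδ
    intro E hE E' hE' hne
    refine disjoint_left.2 fun z hz hz' => ?_
    exact disjoint_left.1 (edgeFamily_disjoint _ _ (hU hE) (hU hE') hne) (mem_filter.1 hz).2
      (mem_filter.1 hz').2

omit hP in
theorem approxRefines_vertexFamily {γ : ℝ} {i : ι} {t : ℕ}
    (h : ApproxRefines γ (transversals {i} (vclass N)) (P.edgeFamily 1 {i})
      (fun e => bit (coord e i)) t) :
    ApproxRefines γ (vclass N i) (P.vertexFamily i) (fun v => bit v.2) t := by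
  classical
  have htr : transversals {i} (vclass N) = powersetCard 1 (vclass N i) := by
    ext e
    simp only [mem_transversals, mem_powersetCard, singleton_biUnion,
      mem_singleton, forall_eq]
    exact and_congr_right fun he => by rw [inter_eq_left.2 he]
  have hsub (W : Finset (ι × (Fin N → Bool))) :
      powersetCard 1 W ⊆ powersetCard 1 (vclass N i) ↔ W ⊆ vclass N i := by
    constructor
    · intro h v hv
      have := h (mem_powersetCard.2 ⟨singleton_subset_iff.2 hv, card_singleton v⟩)
      exact singleton_subset_iff.1 (mem_powersetCard.1 this).1
    · exact fun h => powersetCard_mono h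
  have hfam : P.edgeFamily 1 {i} = (P.vertexFamily i).image (powersetCard 1) := by
    rw [edgeFamily, P.part_one, htr, vertexFamily, filter_image]
    simp only [hsub]
  have hinj : Function.Injective (powersetCard 1 : Finset (ι × (Fin N → Bool)) → _) := by
    intro W W' h
    ext v
    have := congrArg (fun E => {v} ∈ E) h
    simpa [mem_powersetCard] using this
  have hcard (W : Finset (ι × (Fin N → Bool))) : #(powersetCard 1 W) = #W := by
    rw [card_powersetCard, Nat.choose_one_right]
  have hcnt (W : Finset (ι × (Fin N → Bool))) (hW : W ⊆ vclass N i) (c : ℕ → Bool) :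
      #{e ∈ powersetCard 1 W | ∀ j < t, bit (coord e i) j = c j} =
        #{v ∈ W | ∀ j < t, bit v.2 j = c j} := by
    rw [powersetCard_one, filter_map, card_map]
    congr 1
    refine filter_congr fun v hv => ?_
    have hv : v.1 = i := mem_vclass.1 (hW hv)
    have : coord {v} i = v.2 := by
      have h1 : ({v} : Finset (ι × (Fin N → Bool))) = tupleSet {i} (fun _ => v.2) := by
        rw [tupleSet, image_singleton, ← hv]
      rw [h1, coord_tupleSet (mem_singleton_self i)]
    simp [this]
  unfold ApproxRefines at h ⊢
  rw [htr, hcard, hfam, filter_image, sum_image hinj.injOn] at h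
  refine le_trans (le_of_eq ?_) h
  refine sum_congr ?_ fun W _ => by rw [hcard]
  refine filter_congr fun W hW => ?_
  have hW' : W ⊆ vclass N i := (mem_filter.1 hW).2
  unfold IsSpread
  refine forall_congr' fun c => ?_
  rw [hcnt W hW' c, hcard]

end KPartition

/-- The exponents of the errors: the error of the refinement of the edges with `r + 1` vertices is
`2 ^ (-errExp k r)`. -/
def errExp (k : ℕ) : ℕ → ℕ
  | 0 => 4 * k + 20
  | r + 1 => 2 * errExp k r + 16

theorem errExp_add (k r : ℕ) : errExp k r + 16 = (4 * k + 36) * 2 ^ r := by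
  induction r with
  | zero => simp [errExp]
  | succ r ih =>
    rw [pow_succ, ← mul_assoc, ← ih, errExp]
    ring

theorem two_mul_errExp_le {k r : ℕ} (h : r + 2 ≤ k) : 2 * errExp k r + 14 ≤ 16 ^ k := by
  have h1 := errExp_add k r
  have h2 : 2 ^ r * 4 ≤ 2 ^ k := by
    calc 2 ^ r * 4 = 2 ^ (r + 2) := by rw [pow_add]; norm_num
      _ ≤ 2 ^ k := Nat.pow_le_pow_right (by norm_num) h
  have h3 : 2 * k + 18 ≤ 8 ^ k := by
    have hk : 2 ≤ k := by omega
    clear h h1 h2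
    induction k, hk using Nat.le_induction with
    | base => norm_num
    | succ k hk ih => rw [pow_succ]; omega
  have h4 : (2 * k + 18) * (2 ^ r * 4) ≤ 8 ^ k * 2 ^ k := Nat.mul_le_mul h3 h2
  rw [← mul_pow] at h4
  norm_num at h4
  have h5 : 2 * (errExp k r + 16) = (2 * k + 18) * (2 ^ r * 4) := by rw [h1]; ring
  omega

namespace KPartition

variable {ι : Type*} [Fintype ι] [DecidableEq ι] {N n : ℕ}

/-- The clusters of the vertex class with index `i` approximately refine its partition by the first
`t` bits. -/
def VertexRefined (P : KPartition (ι × (Fin N → Bool)) n) (k : ℕ) (i : ι) (t : ℕ) : Prop :=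
  ApproxRefines ((2 : ℝ) ^ errExp k 0)⁻¹ (vclass N i) (P.vertexFamily i) (fun v => bit v.2) t

/-- Refinement of the edges with `r + 1` vertices implies refinement of the vertices. -/
def EdgeToVertex (P : KPartition (ι × (Fin N → Bool)) n) (k r : ℕ) : Prop :=
  ∀ L : List ι, L.Nodup → L.length = r + 1 → ∀ t, bitsNeeded r t ≤ N →
    ApproxRefines ((2 : ℝ) ^ errExp k r)⁻¹ (transversals L.toFinset (vclass N))
      (P.edgeFamily (r + 1) L.toFinset) (fun e => color r L (coord e)) t →
    ∀ i ∈ L, P.VertexRefined k i (growth r t)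

/-- A regular partition of `codeEdges` with refined vertices has refined edges. -/
theorem approxRefines_edgeFamily {P : KPartition (ι × (Fin N → Bool)) n} (hP : P.Refines)
    (hbit : ∀ W ∈ P.vertexPart.parts, ∀ v ∈ W, ∀ v' ∈ W, bit v.2 0 = bit v'.2 0) {k r t i : ℕ}
    (hrk : r + 2 ≤ k) (hrn : r + 1 ≤ n) (hit : i ≤ t) (ht : bitsNeeded (r + 1) t ≤ N)
    {L M : List ι} (hL : L.Nodup) (hLr : L.length = r + 2) (hM : M.Nodup)
    (hMr : M.length = r + 1) {h h' : ι} (hh : h ∈ L.toFinset)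
    (hML : L.toFinset.erase h = M.toFinset) (hh' : h' ∈ M.toFinset) (g : Bool → Bool)
    {c : ℕ → Bool}
    (hcol : ∀ ω : ι → Fin N → Bool, bit (ω h) 0 = g (bit (ω h') 0) →
      ((∀ j < t, color (r + 1) L ω j = c j) ↔
        (tower r).Adj c 0 t (color r M ω) (bit (ω h))))
    (hreg : BipRegularPartition ((2 : ℝ) ^ (2 * errExp k r + 14))⁻¹
      (transversals (L.toFinset.erase h) (vclass N)) (vclass N h)
      (auxGraph (codeEdges N (r + 1) L t c) (transversals (L.toFinset.erase h) (vclass N))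
        (vclass N h)) (P.edgeFamily (r + 1) (L.toFinset.erase h)) (P.vertexFamily h))
    (href : P.VertexRefined k h ((tower r).m i)) :
    ApproxRefines ((2 : ℝ) ^ errExp k r)⁻¹ (transversals M.toFinset (vclass N))
      (P.edgeFamily (r + 1) M.toFinset) (fun e => color r M (coord e)) ((tower r).l i) := by
  rw [hML] at hreg
  have hMS : #M.toFinset = r + 1 := by rw [List.toFinset_card_of_nodup hM, hMr]
  have hmt : (tower r).m t ≤ N :=
    ((tower r).m_mono (Nat.le_succ t)).trans ((le_max_left _ _).trans ht)
  have hlt : bitsUsed r ((tower r).l t) ≤ N :=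
    (bitsUsed_le_bitsNeeded _ _).trans ((le_max_right _ _).trans ht)
  have hhM : h ∉ M.toFinset := by rw [← hML]; exact notMem_erase _ _
  have hinsert : insert h M.toFinset = L.toFinset := by rw [← hML, insert_erase hh]
  have herr := two_mul_errExp_le hrk
  refine (tower r).approxRefines_of_bipRegularPartition (T₀ := 4 * k) (c := c)
    (d := fun e => g (bit (coord e h') 0)) (θ := ((2 : ℝ) ^ (4 * k + 8))⁻¹)
    (η := ((2 : ℝ) ^ (8 * k + 16 + errExp k r))⁻¹)
    (unifBits_transversals hM hMr hlt) (unifBits_vclass h) ⟨(h, fun _ => false), by simp⟩ hit le_rfl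
    hmt ?_ ?_ (fun p hp => (mem_filter.1 hp).2) (edgeFamily_disjoint _ _) ?_
    (fun q hq => (mem_filter.1 hq).2) (vertexFamily_disjoint _) (exists_vertexFamily hP) hreg
    (by positivity) ?_ ?_ (by positivity) (by positivity) ?_ ?_ ?_ href
  · intro x hx v hv hd
    have hins := insert_eq_tupleSet hhM hx hv
    rw [hinsert] at hins
    have hmem : insert v x ∈ transversals L.toFinset (vclass N) := by
      rw [hins]; exact tupleSet_mem_transversals _ _
    have hne : h' ≠ h := fun hEq => hhM (hEq ▸ hh')
    have h1 : color (r + 1) L (coord (insert v x)) =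
        color (r + 1) L (Function.update (coord x) h v.2) := by
      rw [hins]
      exact color_congr _ fun j hj => coord_tupleSet (List.mem_toFinset.2 hj)
    have h2 : color r M (Function.update (coord x) h v.2) = color r M (coord x) :=
      color_congr _ fun j hj => Function.update_of_ne
        (fun hEq => hhM (by rw [← hEq]; exact List.mem_toFinset.2 hj)) _ _
    have h3 := hcol (Function.update (coord x) h v.2)
      (by rw [Function.update_self, Function.update_of_ne hne]; exact hd)
    rw [h2, Function.update_self] at h3
    rw [← h3, auxGraph, mem_filter, mem_product, codeEdges, mem_filter, h1]
    exact ⟨fun H => H.2.2, fun H => ⟨⟨hx, hv⟩, hmem, H⟩⟩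
  · have hsub : codeEdges N (r + 1) L t c ⊆ transversals L.toFinset (vclass N) :=
      filter_subset _ _
    have h1 := card_auxGraph hh hsub
    have h2 := card_transversals (N := N) hh
    rw [hML] at h1 h2
    have hmt' : bitsUsed (r + 1) t ≤ N := hmt
    have h3 := (unifBits_transversals (N := N) hL hLr hmt').card_eq c
    rw [h1, codeEdges, h3, h2]
    push_cast
    exact le_rfl
  · intro E hE x hx y hy
    obtain ⟨W, hW, hxW, hyW⟩ := coord_mem_same_cluster hP (by omega) hrn hMS hE hx hy hh'
    rw [hbit W hW _ hxW _ hyW]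
  · rw [inv_le_comm₀ (by positivity) (by norm_num)]
    have := errExp_add k r
    calc (1 / 2 : ℝ)⁻¹ = 2 ^ 1 := by norm_num
      _ ≤ 2 ^ errExp k r := pow_le_pow_right₀ (by norm_num) (by
          cases r <;> simp only [errExp] <;> omega)
  · rw [pow_add, inv_pow, ← pow_mul, mul_comm (errExp k r) 2, mul_inv, div_eq_mul_inv]
  · intro hT
    exact prod_collision_le r hT (by
      have h1 : 2 ^ (4 * k + 5) = 32 * 16 ^ k := by
        rw [pow_add, pow_mul, mul_comm]; norm_num
      have h2 : k < 16 ^ k := Nat.lt_pow_self (by norm_num)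
      omega)
  · rw [← inv_pow, ← inv_pow, ← inv_pow, ← pow_mul, ← pow_add]
    exact le_of_eq (by congr 1; ring)
  · have e1 : ((2 : ℝ) ^ errExp k 0)⁻¹ = ((2 : ℝ) ^ (4 * k))⁻¹ / 2 ^ 20 := by
      simp only [errExp]
      rw [pow_add, mul_inv]
      rfl
    have e2 : ((2 : ℝ) ^ (4 * k + 8))⁻¹ = ((2 : ℝ) ^ (4 * k))⁻¹ / 2 ^ 8 := by
      rw [pow_add, mul_inv]
      rfl
    rw [e1, e2]
    have : (2 : ℝ) ^ (4 * k) ≠ 0 := by positivity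
    field_simp
    norm_num

/-- A regular partition of `codeEdges` has refined vertices. -/
theorem vertexRefined_of_bipRegularPartition {P : KPartition (ι × (Fin N → Bool)) n}
    (hP : P.Refines)
    (hbit : ∀ W ∈ P.vertexPart.parts, ∀ v ∈ W, ∀ v' ∈ W, ∀ j < 100, bit v.2 j = bit v'.2 j)
    {k r t : ℕ} (hU : P.EdgeToVertex k r) (hrk : r + 2 ≤ k) (hrn : r + 1 ≤ n)
    (ht : bitsNeeded (r + 1) t ≤ N) {L : List ι} (hL : L.Nodup) (hLr : L.length = r + 2)
    {c : ℕ → Bool} (hreg : ∀ h ∈ L.toFinset,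
      BipRegularPartition ((2 : ℝ) ^ (2 * errExp k r + 14))⁻¹
        (transversals (L.toFinset.erase h) (vclass N)) (vclass N h)
        (auxGraph (codeEdges N (r + 1) L t c) (transversals (L.toFinset.erase h) (vclass N))
          (vclass N h)) (P.edgeFamily (r + 1) (L.toFinset.erase h)) (P.vertexFamily h)) :
    ∀ i ∈ L, P.VertexRefined k i (growth (r + 1) t) := by
  have hbit0 : ∀ W ∈ P.vertexPart.parts, ∀ v ∈ W, ∀ v' ∈ W, bit v.2 0 = bit v'.2 0 :=
    fun W hW v hv v' hv' => hbit W hW v hv v' hv' 0 (by norm_num)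
  suffices h : ∀ s ≤ t, ∀ i ∈ L, P.VertexRefined k i ((tower r).m (s + 1)) from h t le_rfl
  intro s
  induction s with
  | zero =>
    intro _ i _
    have hnone : ∀ W ∈ P.vertexFamily i,
        ¬ IsSpread ((2 : ℝ) ^ errExp k 0)⁻¹ (fun v : ι × (Fin N → Bool) => bit v.2)
          ((tower r).m (0 + 1)) W := by
      intro W hW hspread
      have hWP := (mem_filter.1 hW).1
      obtain ⟨v, hv⟩ := P.vertexPart.nonempty_of_mem_parts hWP
      have h1 := hspread (bit v.2)
      rw [filter_true_of_mem fun w hw => by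
        rw [zero_add, tower_m_one]; exact hbit W hWP w hw v hv] at h1
      have h2 : (0 : ℝ) < ((2 : ℝ) ^ errExp k 0)⁻¹ * #W := by
        have : (0 : ℝ) < #W := by exact_mod_cast card_pos.2 ⟨v, hv⟩
        positivity
      linarith
    unfold VertexRefined ApproxRefines
    classical
    rw [filter_false_of_mem hnone, sum_empty]
    positivity
  | succ s ih =>
    intro hs
    have ih' := ih (by omega)
    have hneed : bitsNeeded r ((tower r).l (s + 1)) ≤ N :=
      (bitsNeeded_mono r ((tower r).l_mono hs)).trans ((le_max_right _ _).trans ht)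
    rcases L with _ | ⟨p, _ | ⟨q, L⟩⟩
    · simp at hLr
    · simp at hLr
    have hpq : p ≠ q := by rintro rfl; simp at hL
    have hpL : p ∉ q :: L := (List.nodup_cons.1 hL).1
    have hqL : q ∉ p :: L := by
      have := (List.nodup_cons.1 (List.nodup_cons.1 hL).2).1
      simp [this, hpq.symm]
    have hLq : (q :: L).Nodup := (List.nodup_cons.1 hL).2
    have hLp : (p :: L).Nodup :=
      List.nodup_cons.2 ⟨fun h => hpL (List.mem_cons_of_mem _ h), (List.nodup_cons.1 hLq).2⟩
    have hperm : (p :: q :: L).toFinset = (q :: p :: L).toFinset := by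
      simp only [List.toFinset_cons]
      exact insert_comm _ _ _
    have hp := approxRefines_edgeFamily hP hbit0 hrk hrn hs ht hL hLr hLq (by simpa using hLr)
      (h := p) (h' := q) (by simp)
      (by rw [List.toFinset_cons, erase_insert (by rwa [List.mem_toFinset])]) (by simp) id
      (fun ω hω => forall_color_iff_of_eq hω) (hreg p (by simp)) (ih' p (by simp))
    have hq := approxRefines_edgeFamily hP hbit0 hrk hrn hs ht hL hLr hLp (by simpa using hLr)
      (h := q) (h' := p) (by simp)
      (by rw [hperm, List.toFinset_cons, erase_insert (by rwa [List.mem_toFinset])]) (by simp) not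
      (fun ω hω => forall_color_iff_of_ne (by rw [hω]; cases bit (ω p) 0 <;> simp))
      (hreg q (by simp)) (ih' q (by simp))
    intro i hi
    rw [show s + 1 + 1 = s + 2 from rfl, tower_m_succ_succ]
    rcases List.mem_cons.1 hi with rfl | hi
    · exact hU _ hLp (by simpa using hLr) _ hneed hq i (by simp)
    · exact hU _ hLq (by simpa using hLr) _ hneed hp i hi

theorem edgeToVertex {P : KPartition (ι × (Fin N → Bool)) n} (hP : P.Refines)
    (hbit : ∀ W ∈ P.vertexPart.parts, ∀ v ∈ W, ∀ v' ∈ W, ∀ j < 100, bit v.2 j = bit v'.2 j)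
    {k : ℕ} (hgood : P.IsGood ((2 : ℝ) ^ (16 ^ k))⁻¹) (hnk : n ≤ k) {r : ℕ} (hrn : r + 1 ≤ n) :
    P.EdgeToVertex k r := by
  induction r with
  | zero =>
    intro L _ hL t _ href i hi
    obtain ⟨p, rfl⟩ := List.length_eq_one_iff.1 hL
    rw [List.mem_singleton.1 hi]
    exact approxRefines_vertexFamily href
  | succ r ih =>
    intro L hL hLr t ht href
    have herr := two_mul_errExp_le (show r + 2 ≤ k by omega)
    obtain ⟨c, hc⟩ := exists_bipRegularPartition hP hgood (by positivity)
      (δ' := ((2 : ℝ) ^ (2 * errExp k r + 14))⁻¹)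
      (inv_anti₀ (by positivity) (pow_le_pow_right₀ (by norm_num) herr))
      (by
        simp only [errExp]
        rw [show 2 * errExp k r + 16 = 2 * errExp k r + 14 + 2 by ring, pow_add _ _ 2, mul_inv]
        refine le_of_eq ?_
        ring) hrn hL hLr ((bitsUsed_le_bitsNeeded _ _).trans ht) href
    exact vertexRefined_of_bipRegularPartition hP hbit (ih (by omega)) (by omega) (by omega) ht hL
      hLr hc

/-- Refined vertices come in many clusters. -/
theorem VertexRefined.two_pow_le_card {P : KPartition (ι × (Fin N → Bool)) n} {k : ℕ} {i : ι}
    {t : ℕ} (h : P.VertexRefined k i t) (hP : P.Refines) (ht : t ≤ N) :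
    2 ^ t ≤ 2 * #(P.vertexFamily i) := by
  classical
  set γ : ℝ := ((2 : ℝ) ^ errExp k 0)⁻¹ with hγdef
  have hγ0 : 0 < γ := by positivity
  have hγ : γ ≤ 1 / 4 := by
    rw [hγdef, inv_le_comm₀ (by positivity) (by norm_num)]
    calc (1 / 4 : ℝ)⁻¹ = 2 ^ 2 := by norm_num
      _ ≤ 2 ^ errExp k 0 := pow_le_pow_right₀ (by norm_num) (by simp only [errExp]; omega)
  set X := vclass N i with hX
  set F := P.vertexFamily i
  have hXpos : (0 : ℝ) < #X := by
    exact_mod_cast card_pos.2 ⟨(i, fun _ => false), by simp [hX]⟩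
  have hunif := (unifBits_vclass i).mono ht
  have hcover : (#X : ℝ) ≤ ∑ W ∈ F, (#W : ℝ) := by
    have : X ⊆ F.biUnion id := fun v hv => by
      obtain ⟨W, hW, hvW⟩ := exists_vertexFamily hP v hv
      exact mem_biUnion.2 ⟨W, hW, hvW⟩
    exact_mod_cast (card_le_card this).trans card_biUnion_le
  rw [← sum_filter_add_sum_filter_not F (IsSpread γ (fun v : ι × (Fin N → Bool) => bit v.2) t)]
    at hcover
  have hbad : (∑ W ∈ F with IsSpread γ (fun v : ι × (Fin N → Bool) => bit v.2) t W, (#W : ℝ)) ≤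
      γ * #X := h
  have hgood : (∑ W ∈ F with ¬ IsSpread γ (fun v : ι × (Fin N → Bool) => bit v.2) t W, (#W : ℝ)) ≤
      #F * (#X / 2 ^ t / (1 - γ)) := by
    calc _ ≤ ∑ W ∈ F with ¬ IsSpread γ (fun v : ι × (Fin N → Bool) => bit v.2) t W,
          ((#X : ℝ) / 2 ^ t / (1 - γ)) := by
          refine sum_le_sum fun W hW => ?_
          obtain ⟨hWF, hWs⟩ := mem_filter.1 hW
          unfold IsSpread at hWs
          push Not at hWs
          obtain ⟨c, hc⟩ := hWs
          rw [le_div_iff₀ (by linarith), ← hunif.card_eq c, mul_comm]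
          refine hc.trans ?_
          exact_mod_cast card_le_card (filter_subset_filter _ (mem_filter.1 hWF).2)
      _ ≤ _ := by
          have : 0 < 1 - γ := by linarith
          rw [sum_const, nsmul_eq_mul]
          gcongr
          exact filter_subset _ _
  have h1 : (1 - γ) * #X ≤ #F * (#X / 2 ^ t / (1 - γ)) := by linarith
  have h1γ : 0 < 1 - γ := by linarith
  have h2 : (1 - γ) * (1 - γ) * 2 ^ t ≤ #F := by
    have e : (#F : ℝ) * (#X / 2 ^ t / (1 - γ)) = #F / (2 ^ t * (1 - γ)) * #X := by
      field_simp
    rw [e] at h1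
    have h3 := le_of_mul_le_mul_right h1 hXpos
    rw [le_div_iff₀ (by positivity)] at h3
    linarith
  have h3 : (1 / 2 : ℝ) ≤ (1 - γ) * (1 - γ) := by nlinarith
  have h4 : (1 / 2 : ℝ) * 2 ^ t ≤ (1 - γ) * (1 - γ) * 2 ^ t := by gcongr
  have h5 : (2 : ℝ) ^ t ≤ 2 * #F := by linarith
  exact_mod_cast h5

end KPartition

/-- The partition of a finite type into the fibres of a map. -/
def fibrePartition {V Y : Type*} [Fintype V] [DecidableEq V] [DecidableEq Y] (f : V → Y) :
    Finpartition (univ : Finset V) :=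
  @Finpartition.ofSetoid V _ _ (Setoid.ker f) fun a b => decEq (f a) (f b)

theorem card_fibrePartition_le {V Y : Type*} [Fintype V] [DecidableEq V] [Fintype Y]
    [DecidableEq Y] (f : V → Y) : #(fibrePartition f).parts ≤ Fintype.card Y := by
  have h : (fibrePartition f).parts ⊆ univ.image fun y => ({v | y = f v} : Finset V) := by
    intro W hW
    simp only [fibrePartition, Finpartition.ofSetoid, Finpartition.ofSetSetoid, mem_image, mem_univ, true_and] at hW
    obtain ⟨a, rfl⟩ := hW
    exact mem_image.2 ⟨f a, mem_univ _, rfl⟩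
  exact (card_le_card h).trans card_image_le

theorem eq_of_mem_fibrePartition {V Y : Type*} [Fintype V] [DecidableEq V] [DecidableEq Y]
    {f : V → Y} {W : Finset V} (hW : W ∈ (fibrePartition f).parts) {a b : V} (ha : a ∈ W)
    (hb : b ∈ W) : f a = f b := by
  simp only [fibrePartition, Finpartition.ofSetoid, Finpartition.ofSetSetoid, mem_image, mem_univ, true_and] at hW
  obtain ⟨c, rfl⟩ := hW
  have h1 : f c = f a := (mem_filter.1 ha).2
  have h2 : f c = f b := (mem_filter.1 hb).2
  exact h1.symm.trans h2

theorem BipRegularPartition.mono {α β : Type*} [DecidableEq α] [DecidableEq β] {δ δ' : ℝ}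
    {X : Finset α} {Y : Finset β} {G : Finset (α × β)} {PX : Finset (Finset α)}
    {PY : Finset (Finset β)} (h : BipRegularPartition δ X Y G PX PY) (hδ : δ ≤ δ') :
    BipRegularPartition δ' X Y G PX PY := by
  obtain ⟨G', hG', hcard, hreg⟩ := h
  exact ⟨G', hG', hcard.trans (mul_le_mul_of_nonneg_right hδ (Nat.cast_nonneg _)),
    fun A hA B hB => (hreg A hA B hB).mono hδ⟩

theorem card_vclass {ι : Type*} [Fintype ι] [DecidableEq ι] (N : ℕ) (i : ι) :
    #(vclass N i) = 2 ^ N := by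
  have h : vclass N i = univ.image fun w => (i, w) := by
    ext ⟨j, w⟩
    simp [eq_comm]
  rw [h, card_image_of_injective _ fun w w' hw => (Prod.mk.inj hw).2]
  simp

theorem card_transversals_univ {ι : Type*} [Fintype ι] [DecidableEq ι] (N : ℕ) :
    #(transversals (univ : Finset ι) (vclass N)) = ∏ i : ι, #(vclass N i) := by
  rw [transversals_eq_image, card_image_of_injective]
  · simp [card_vclass]
  · exact fun ω ω' h => funext fun i => tupleSet_eq_iff.1 h i (mem_univ i)

/-- The hypergraph `codeEdges` as a partite hypergraph. -/
noncomputable def codeHypergraph (N r t : ℕ) :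
    PartiteHypergraph (Fin (r + 2) × (Fin N → Bool)) (r + 2) where
  cls := vclass N
  cls_disjoint i j hij := disjoint_left.2 fun v hi hj =>
    hij ((mem_vclass.1 hi).symm.trans (mem_vclass.1 hj))
  cls_cover := by
    ext v
    simp
  edges := codeEdges N (r + 1) (List.finRange (r + 2)) t fun _ => true
  edges_subset := by
    have h : codeEdges N (r + 1) (List.finRange (r + 2)) t (fun _ => true) ⊆
        transversals (List.finRange (r + 2)).toFinset (vclass N) := filter_subset _ _
    rwa [List.toFinset_finRange] at h

theorem density_codeHypergraph {N r t : ℕ} (ht : bitsUsed (r + 1) t ≤ N) :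
    (codeHypergraph N r t).density = ((2 : ℝ) ^ t)⁻¹ := by
  have h := (unifBits_transversals (List.nodup_finRange (r + 2)) (List.length_finRange) ht).card_eq
    fun _ => true
  have h0 : (0 : ℝ) < ∏ i : Fin (r + 2), (#(vclass N i) : ℝ) :=
    prod_pos fun i _ => by rw [card_vclass]; positivity
  have h1 := card_transversals_univ (ι := Fin (r + 2)) N
  rw [List.toFinset_finRange, h1] at h
  push_cast at h
  have e : (codeHypergraph N r t).density =
      (#{e ∈ transversals (List.finRange (r + 2)).toFinset (vclass N) |
        ∀ j < t, color (r + 1) (List.finRange (r + 2)) (coord e) j = true} : ℝ) /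
        ∏ i : Fin (r + 2), (#(vclass N i) : ℝ) := rfl
  rw [e, List.toFinset_finRange, h]
  field_simp

theorem Ack_le_card_of_isRegularPartition {N r t : ℕ} (hN : bitsNeeded (r + 1) t ≤ N)
    {P : KPartition (Fin (r + 2) × (Fin N → Bool)) (r + 1)}
    (hreg : (codeHypergraph N r t).IsRegularPartition P ((2 : ℝ) ^ (16 ^ (r + 2)))⁻¹)
    (hbit : ∀ W ∈ P.vertexPart.parts, ∀ v ∈ W, ∀ v' ∈ W, ∀ j < 100, bit v.2 j = bit v'.2 j) :
    Ack (r + 2) t ≤ #P.vertexPart.parts := by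
  obtain ⟨hgood, hP : P.Refines, hpart⟩ := hreg
  have hδ : ((2 : ℝ) ^ (16 ^ (r + 2)))⁻¹ ≤ ((2 : ℝ) ^ (2 * errExp (r + 2) r + 14))⁻¹ :=
    inv_anti₀ (by positivity) (pow_le_pow_right₀ (by norm_num) (two_mul_errExp_le le_rfl))
  have hU := KPartition.edgeToVertex hP hbit hgood (Nat.le_succ _) (le_refl (r + 1))
  have href := KPartition.vertexRefined_of_bipRegularPartition hP hbit hU le_rfl le_rfl hN
    (List.nodup_finRange (r + 2)) List.length_finRange (c := fun _ => true) (by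
      rw [List.toFinset_finRange]
      exact fun h _ => (hpart h).mono hδ) 0 (List.mem_finRange 0)
  have h1 := href.two_pow_le_card hP ((growth_le_bitsNeeded _ _).trans hN)
  have h2 := two_mul_Ack_le_growth r t
  have h3 : growth (r + 1) t < 2 ^ growth (r + 1) t := Nat.lt_two_pow_self
  have h4 : #(P.vertexFamily 0) ≤ #P.vertexPart.parts := card_le_card (filter_subset _ _)
  omega

theorem theorem2p8 (k : ℕ) (hk : 2 ≤ k) (s : ℕ) :
    ∃ (V : Type) (_ : Fintype V) (_ : DecidableEq V) (H : PartiteHypergraph V k)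
      (V₀ : Finpartition (univ : Finset V)),
      H.density = ((2 : ℝ) ^ (s + k))⁻¹ ∧
      V₀.parts.card ≤ 2 ^ 200 * k ∧
      ∀ P : KPartition V (k - 1),
        H.IsRegularPartition P (((2 : ℝ) ^ (16 ^ k))⁻¹) →
        P.vertexPart ≤ V₀ →
        Ack k s ≤ P.vertexPart.parts.card := by
  obtain ⟨r, rfl⟩ := Nat.exists_eq_add_of_le' hk
  set t := s + (r + 2)
  set N := bitsNeeded (r + 1) t
  refine ⟨Fin (r + 2) × (Fin N → Bool), inferInstance, inferInstance, codeHypergraph N r t,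
    fibrePartition fun v => (v.1, fun j : Fin 100 => bit v.2 j),
    density_codeHypergraph (bitsUsed_le_bitsNeeded _ _), ?_, ?_⟩
  · refine (card_fibrePartition_le _).trans ?_
    rw [Fintype.card_prod, Fintype.card_fin, Fintype.card_fun, Fintype.card_bool, Fintype.card_fin,
      mul_comm]
    exact Nat.mul_le_mul_right _ (Nat.pow_le_pow_right (by norm_num) (by norm_num))
  · intro P hreg hle
    refine (Ack_mono (r + 1) (Nat.le_add_right s (r + 2))).trans
      (Ack_le_card_of_isRegularPartition le_rfl hreg fun W hW v hv v' hv' j hj => ?_)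
    obtain ⟨W₀, hW₀, hWW₀⟩ := hle hW
    have h := eq_of_mem_fibrePartition hW₀ (hWW₀ hv) (hWW₀ hv')
    exact congrFun (Prod.mk.inj h).2 ⟨j, hj⟩
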